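/- Let $k$ be a field. All label sets $I, J$ below are finite and nonempty. A \emph{shrub} on $I$ is a simple graph on $I$ together with a height function $h : I \to \mathbb{N}$ such that: (1) if $i - j$ is an edge then $h(i) = h(j) \pm 1$; (2) if $h(j) > 0$ there is an edge $i - j$ with $h(i) = h(j) - 1$; (3) neither of the following patterns (up to a shift of the height) occurs as an induced subgraph: two vertices $a, b$ at height $1$ and three vertices $c, d, e$ at height $0$ with edges exactly $a-c,\ a-d,\ b-d,\ b-e$; and one vertex $a$ at height $2$, two vertices $b, c$ at height $1$ and one vertex $d$ at height $0$ with edges exactly $a-b,\ a-c,\ b-d$. Shrubs form a set operad $\mathrm{Arb}$, whose unit is the one-vertex shrub: for shrubs $P$ on $I$ and $P'$ on $J$ and $i \in I$, the shrub $P \circ_i P'$ on $(I \setminus \{i\}) \sqcup J$ is obtained from the disjoint union of $P'$ and of $P$ without the vertex $i$ by joining every neighbour of $i$ in $P$ to every vertex of height $0$ of $P'$; heights are those of $P$ on $I \setminus \{i\}$ and those of $P'$ increased by $h_P(i)$ on $J$. Write $[2 \triangleleft 1]$ for the rooted tree with root $2$ (height $0$) and leaf $1$ (height $1$), and $[1][2]$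 for the shrub with two isolated vertices of height $0$. In the operad $\mathrm{Zinb}$ over $k$, $\mathrm{Zinb}(I)$ is the vector space with basis the total orders on $I$, written as lists with the minimum on the left. The composition is bilinear, and $\pi \circ_i \sigma$ is the sum of all total orders on $(I \setminus \{i\}) \sqcup J$ that extend $\pi|_{I \setminus \{i\}}$ and $\sigma$, put every element smaller than $i$ in $\pi$ before all of $J$, and put every element larger than $i$ in $\pi$ after the minimum of $\sigma$. In the operad $\mathrm{Mould}$ over $k$, $\mathrm{Mould}(I)$ is the field of rational fractions $k(u_i : i \in I)$, with unit $1/u$ and $$f \circ_i g = \Big(\sum_{j \in J} u_j\Big)\, g\; f\big|_{u_i = \sum_{j \in J} u_j}.$$ The linear inclusion $\mathrm{Zinb}(I) \to \mathrm{Mould}(I)$ sends a total order $\pi$ to $1 / \prod_{i \in I} \sum_{j \geq_\pi i} u_j$. There is a unique morphism of operads (compatible with relabelling, units and partial compositions) $\gamma : \mathrm{Arb} \to \mathrm{Zinb}$ with $\gamma([2 \triangleleft 1]) = [21]$ and $\gamma([1][2]) = [12] + [21]$. There is a unique morphism of operads $\kappa : \mathrm{Arb} \to \mathrm{Mould}$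 with $\kappa([2 \triangleleft 1]) = \frac{1}{u_1(u_1 + u_2)}$ and $\kappa([1][2]) = \frac{1}{u_1 u_2}$, and $\kappa$ is the composite of $\gamma$ with the inclusion $\mathrm{Zinb} \to \mathrm{Mould}$. \textbf{Proposition.} The morphisms $\gamma$ and $\kappa$ are injective: for every finite nonempty set $I$, the maps $\gamma_I$ from the set of shrubs on $I$ to $\mathrm{Zinb}(I)$ and $\kappa_I$ from the set of shrubs on $I$ to $\mathrm{Mould}(I)$ are injective. -/

import Mathlib

/-! ## Set operads, in partial-composition form -/

/-- The structure maps of a (symmetric, unital) operad in sets, in the species-style partial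
composition form: a set `obj I` for every set `I` of labels, relabelling along bijections, a unit
on the one-point set, and partial compositions `x ∘_i y`, labelled by `I \ {i} ⊔ J`. Only
nonempty finite label sets are used (there is no arity zero). -/
structure OperadData where
  obj : Type → Type*
  map : ∀ {I J : Type}, I ≃ J → obj I → obj J
  unit : obj Unit
  comp : ∀ {I J : Type} [Finite I] [Finite J] [Nonempty J] (i : I),
    obj I → obj J → obj ({a : I // a ≠ i} ⊕ J)

/-- Morphisms of operads: families of maps, one for every nonempty finite set, compatible with
relabelling, with the units and with all partial compositions. -/
@[ext]
structure OperadHom (O O' : OperadData) where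
  toFun : ∀ (I : Type) [Finite I] [Nonempty I], O.obj I → O'.obj I
  map_relabel : ∀ {I J : Type} [Finite I] [Nonempty I] [Finite J] [Nonempty J]
    (e : I ≃ J) (x : O.obj I), toFun J (O.map e x) = O'.map e (toFun I x)
  map_unit : toFun Unit O.unit = O'.unit
  map_comp : ∀ {I J : Type} [Finite I] [Nonempty I] [Finite J] [Nonempty J]
    (i : I) (x : O.obj I) (y : O.obj J),
    toFun ({a : I // a ≠ i} ⊕ J) (O.comp i x y) = O'.comp i (toFun I x) (toFun J y)

/-! ## Shrubs -/

/-- For a graph with a height function: `j` covers `i` if `i - j` is an edge and `j` is one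
step higher than `i`. -/
def Covers {I : Type} (G : SimpleGraph I) (h : I → ℕ) (j i : I) : Prop :=
  G.Adj i j ∧ h j = h i + 1

/-- A shrub ("arbuste") on the set `I`: a graph with a height function such that adjacent vertices
have heights differing by one, every vertex of positive height covers some vertex, and the two
forbidden patterns (up to a shift of the height) do not occur as induced subgraphs. -/
@[ext]
structure Shrub (I : Type) where
  graph : SimpleGraph I
  height : I → ℕ
  height_adj : ∀ i j, graph.Adj i j → height i = height j + 1 ∨ height j = height i + 1
  exists_covered : ∀ j, 0 < height j → ∃ i, Covers graph height j i
  /-- Forbidden: two upper vertices `a`, `b` and three lower vertices `c`, `d`, `e`, whose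
  edges are exactly `a - c`, `a - d`, `b - d`, `b - e`. (The five vertices are then
  automatically distinct, and vertices of the same height are never adjacent.) -/
  no_pattern_five : ¬ ∃ a b c d e : I,
    Covers graph height a c ∧ Covers graph height a d ∧
    Covers graph height b d ∧ Covers graph height b e ∧
    ¬ graph.Adj a e ∧ ¬ graph.Adj b c
  /-- Forbidden: an upper vertex `a`, two middle vertices `b`, `c` and a lower vertex `d`, whose
  edges are exactly `a - b`, `a - c`, `b - d`. -/
  no_pattern_four : ¬ ∃ a b c d : I,
    Covers graph height a b ∧ Covers graph height a c ∧ Covers graph height b d ∧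
    ¬ graph.Adj c d

namespace Shrub

/-- Relabelling the vertices of a shrub. -/
def relabel {I J : Type} (e : I ≃ J) (P : Shrub I) : Shrub J where
  graph := P.graph.comap e.symm
  height := fun j => P.height (e.symm j)
  height_adj := fun i j h => P.height_adj _ _ h
  exists_covered := by
    intro j hj
    obtain ⟨i, hi⟩ := P.exists_covered _ hj
    exact ⟨e i, by simpa [Covers] using hi⟩
  no_pattern_five := by
    rintro ⟨a, b, c, d, f, h⟩
    exact P.no_pattern_five ⟨e.symm a, e.symm b, e.symm c, e.symm d, e.symm f, h⟩
  no_pattern_four := by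
    rintro ⟨a, b, c, d, h⟩
    exact P.no_pattern_four ⟨e.symm a, e.symm b, e.symm c, e.symm d, h⟩

/-- The shrub on `I` with no edges and all heights zero. -/
def edgeless (I : Type) : Shrub I where
  graph := ⊥
  height := fun _ => 0
  height_adj := by simp
  exists_covered := by simp
  no_pattern_five := by simp [Covers]
  no_pattern_four := by simp [Covers]

/-- The rooted tree on `{1, 2}` (coded as `{0, 1} = Fin 2`) with root `2` and leaf `1`. -/
def rootTwo : Shrub (Fin 2) where
  graph := ⊤
  height := ![1, 0]
  height_adj := by decide
  exists_covered := by
    intro j hj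
    fin_cases j
    · exact ⟨1, by simp [Covers]⟩
    · simp at hj
  no_pattern_five := by
    rintro ⟨a, b, c, d, e, h1, h2, h3, h4, h5, h6⟩
    revert h1 h2 h3 h4 h5 h6
    fin_cases a <;> fin_cases b <;> fin_cases c <;> fin_cases e <;> simp [Covers]
  no_pattern_four := by
    rintro ⟨a, b, c, d, h1, h2, h3, h4⟩
    revert h1 h2 h3 h4
    fin_cases a <;> fin_cases b <;> fin_cases c <;> fin_cases d <;> simp [Covers]

section comp

variable {I J : Type} (i : I) (P : Shrub I) (Q : Shrub J)

/-- Adjacency in `P ∘_i Q`: the edges of `P` away from `i`, the edges of `Q`, and an edge between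
each neighbour of `i` in `P` and each vertex of height zero of `Q`. -/
def compAdj : {a : I // a ≠ i} ⊕ J → {a : I // a ≠ i} ⊕ J → Prop
  | .inl a, .inl b => P.graph.Adj a b
  | .inr a, .inr b => Q.graph.Adj a b
  | .inl a, .inr b => P.graph.Adj a i ∧ Q.height b = 0
  | .inr a, .inl b => P.graph.Adj b i ∧ Q.height a = 0

/-- The graph of `P ∘_i Q`. -/
def compGraph : SimpleGraph ({a : I // a ≠ i} ⊕ J) where
  Adj := compAdj i P Q
  symm := ⟨by
    rintro (a | a) (b | b) h
    · exact SimpleGraph.Adj.symm (G := P.graph) h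
    · exact h
    · exact h
    · exact SimpleGraph.Adj.symm (G := Q.graph) h⟩
  loopless := ⟨by
    rintro (a | a) h
    · exact P.graph.irrefl h
    · exact Q.graph.irrefl h⟩

/-- The height function of `P ∘_i Q`. -/
def compHeight : {a : I // a ≠ i} ⊕ J → ℕ
  | .inl a => P.height a
  | .inr b => Q.height b + P.height i

theorem exists_height_zero [Nonempty J] : ∃ b, Q.height b = 0 := by
  have h : ∀ n, ∀ b, Q.height b = n → ∃ b, Q.height b = 0 := by
    intro n
    induction n with
    | zero => exact fun b hb => ⟨b, hb⟩
    | succ n ih =>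
      intro b hb
      obtain ⟨c, -, hc⟩ := Q.exists_covered b (by omega)
      exact ih c (by omega)
  obtain ⟨b⟩ := ‹Nonempty J›
  exact h _ b rfl

theorem four (a b c d : I) (h1 : Covers P.graph P.height a b) (h2 : Covers P.graph P.height a c)
    (h3 : Covers P.graph P.height b d) : P.graph.Adj c d := by
  by_contra h
  exact P.no_pattern_four ⟨a, b, c, d, h1, h2, h3, h⟩

theorem five (a b c d e : I) (h1 : Covers P.graph P.height a c)
    (h2 : Covers P.graph P.height a d) (h3 : Covers P.graph P.height b d)
    (h4 : Covers P.graph P.height b e) : P.graph.Adj a e ∨ P.graph.Adj b c := by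
  by_contra h
  exact P.no_pattern_five ⟨a, b, c, d, e, h1, h2, h3, h4, by tauto, by tauto⟩

/-- The partial composition `P ∘_i Q` of shrubs. -/
def comp [Nonempty J] : Shrub ({a : I // a ≠ i} ⊕ J) where
  graph := compGraph i P Q
  height := compHeight i P Q
  height_adj := by
    rintro (a | a) (b | b) h <;>
      simp only [compGraph, compAdj] at h <;> simp only [compHeight]
    · exact P.height_adj _ _ h
    · have := P.height_adj _ _ h.1
      omega
    · have := P.height_adj _ _ h.1
      omega
    · have := Q.height_adj _ _ h
      omega
  exists_covered := by
    rintro (a | a) h <;> simp only [compHeight] at h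
    · obtain ⟨b, hb, hb'⟩ := P.exists_covered _ h
      by_cases hbi : b = i
      · subst hbi
        obtain ⟨c, hc⟩ := exists_height_zero Q
        exact ⟨.inr c, ⟨hb.symm, hc⟩, by simp only [compHeight]; omega⟩
      · exact ⟨.inl ⟨b, hbi⟩, hb, hb'⟩
    · by_cases ha : Q.height a = 0
      · obtain ⟨b, hb, hb'⟩ := P.exists_covered i (by omega)
        exact ⟨.inl ⟨b, hb.ne⟩, ⟨hb, ha⟩, by simp only [compHeight]; omega⟩
      · obtain ⟨b, hb, hb'⟩ := Q.exists_covered a (by omega)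
        exact ⟨.inr b, hb, by simp only [compHeight]; omega⟩
  no_pattern_five := by
    have hP := P.five
    have hQ := Q.five
    have sP := fun a b => P.graph.adj_comm a b
    have sQ := fun a b => Q.graph.adj_comm a b
    simp only [Covers] at hP hQ
    rintro ⟨a | a, b | b, c | c, d | d, e | e, ⟨h1, k1⟩, ⟨h2, k2⟩, ⟨h3, k3⟩, ⟨h4, k4⟩, h5, h6⟩ <;>
      simp only [compGraph, compAdj, compHeight] at h1 h2 h3 h4 h5 h6 k1 k2 k3 k4 <;>
      grind
  no_pattern_four := by
    have hP := P.four
    have hQ := Q.four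
    have sP := fun a b => P.graph.adj_comm a b
    have sQ := fun a b => Q.graph.adj_comm a b
    simp only [Covers] at hP hQ
    rintro ⟨a | a, b | b, c | c, d | d, ⟨h1, k1⟩, ⟨h2, k2⟩, ⟨h3, k3⟩, h4⟩ <;>
      simp only [compGraph, compAdj, compHeight] at h1 h2 h3 h4 k1 k2 k3 <;>
      grind

end comp

end Shrub

/-- The operad `Arb` of shrubs. -/
def Arb : OperadData where
  obj := Shrub
  map := Shrub.relabel
  unit := Shrub.edgeless Unit
  comp := fun i P Q => Shrub.comp i P Q

/-! ## The Zinbiel operad -/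

/-- Total orders on a set. -/
@[ext]
structure TotalOrder (I : Type) where
  le : I → I → Prop
  refl : ∀ a, le a a
  trans : ∀ a b c, le a b → le b c → le a c
  antisymm : ∀ a b, le a b → le b a → a = b
  total : ∀ a b, le a b ∨ le b a

namespace TotalOrder

instance {I : Type} [Finite I] : Finite (TotalOrder I) :=
  Finite.of_injective (fun π : TotalOrder I => π.le) (fun _ _ h => TotalOrder.ext h)

/-- Relabelling a total order along a bijection. -/
def relabel {I J : Type} (e : I ≃ J) (π : TotalOrder I) : TotalOrder J where
  le := fun a b => π.le (e.symm a) (e.symm b)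
  refl := fun _ => π.refl _
  trans := fun _ _ _ => π.trans _ _ _
  antisymm := fun _ _ h h' => e.symm.injective (π.antisymm _ _ h h')
  total := fun _ _ => π.total _ _

/-- The order `[1 2 ... n]` (that is `1 < 2 < ... < n`) on `{1, ..., n}`, coded as `Fin n`. -/
def increasing (n : ℕ) : TotalOrder (Fin n) where
  le := fun a b => a ≤ b
  refl := le_refl
  trans := fun _ _ _ => le_trans
  antisymm := fun _ _ => le_antisymm
  total := le_total

/-- The order `[n ... 2 1]` (that is `n < ... < 2 < 1`) on `{1, ..., n}`, coded as `Fin n`. -/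
def decreasing (n : ℕ) : TotalOrder (Fin n) where
  le := fun a b => b ≤ a
  refl := le_refl
  trans := fun _ _ _ h h' => le_trans h' h
  antisymm := fun _ _ h h' => le_antisymm h' h
  total := fun a b => le_total b a

/-- The unique total order on a point. -/
def point : TotalOrder Unit where
  le := fun _ _ => True
  refl := fun _ => trivial
  trans := fun _ _ _ _ _ => trivial
  antisymm := fun _ _ _ _ => rfl
  total := fun _ _ => Or.inl trivial

/-- `τ` is one of the total orders occurring in `π ∘_i σ`: a shuffle of `σ` with `π`, in which the
first element of `σ` takes the place of `i` in `π` while the others stay to its right. That is,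
`τ` extends `π` away from `i`, extends `σ`, puts everything that precedes `i` in `π` before
all of `σ`, and puts everything that follows `i` in `π` after the minimum of `σ`. -/
def IsComposite {I J : Type} (i : I) (π : TotalOrder I) (σ : TotalOrder J)
    (τ : TotalOrder ({a : I // a ≠ i} ⊕ J)) : Prop :=
  (∀ a b : {a : I // a ≠ i}, π.le a b → τ.le (.inl a) (.inl b)) ∧
  (∀ a b : J, σ.le a b → τ.le (.inr a) (.inr b)) ∧
  (∀ (a : {a : I // a ≠ i}) (b : J), π.le a i → τ.le (.inl a) (.inr b)) ∧
  (∀ (a : {a : I // a ≠ i}) (b : J), (∀ c, σ.le b c) → π.le i a → τ.le (.inr b) (.inl a))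

end TotalOrder

open Classical in
/-- The composition `π ∘_i σ` of two total orders in the Zinbiel operad: the sum of the total
orders occurring in it. -/
noncomputable def zinbBasisComp (k : Type*) [Field k] {I J : Type} [Finite I] [Finite J] (i : I)
    (π : TotalOrder I) (σ : TotalOrder J) : TotalOrder ({a : I // a ≠ i} ⊕ J) →₀ k :=
  letI := Fintype.ofFinite (TotalOrder ({a : I // a ≠ i} ⊕ J))
  ∑ τ : TotalOrder ({a : I // a ≠ i} ⊕ J) with π.IsComposite i σ τ, Finsupp.single τ 1

/-- The Zinbiel operad over the field `k`: `Zinb(I)` is the vector space with basis the total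
orders on `I`, and the composition is bilinear. -/
noncomputable def Zinb (k : Type*) [Field k] : OperadData where
  obj := fun I => TotalOrder I →₀ k
  map := fun e x => x.mapDomain (TotalOrder.relabel e)
  unit := Finsupp.single TotalOrder.point 1
  comp := fun i x y => x.sum fun π a => y.sum fun σ b => (a * b) • zinbBasisComp k i π σ

/-! ## The operad of moulds -/

/-- The field of rational fractions in the indeterminates `u_i`, `i ∈ I`. -/
abbrev Fractions (k : Type*) [Field k] (I : Type) : Type _ := FractionRing (MvPolynomial I k)

namespace Fractions

variable (k : Type*) [Field k] {I J : Type}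

/-- The indeterminate `u_i`. -/
noncomputable def u (i : I) : Fractions k I :=
  algebraMap (MvPolynomial I k) (Fractions k I) (MvPolynomial.X i)

/-- The morphism of fields sending `u_i` to `u_{e i}`. -/
noncomputable def relabel (e : I ≃ J) : Fractions k I →+* Fractions k J :=
  IsFractionRing.lift (A := MvPolynomial I k) (K := Fractions k I)
    (g := (algebraMap (MvPolynomial J k) (Fractions k J)).comp
      (MvPolynomial.rename e).toRingHom)
    ((IsFractionRing.injective _ _).comp (MvPolynomial.rename_injective e e.injective))

open Classical in
/-- On polynomials: substitute `∑_{j ∈ J} u_j` for `u_i` and keep the other variables. -/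
noncomputable def polySubst [Finite J] (i : I) :
    MvPolynomial I k →ₐ[k] MvPolynomial ({a : I // a ≠ i} ⊕ J) k :=
  MvPolynomial.aeval fun a =>
    if h : a = i then ∑ᶠ j : J, MvPolynomial.X (.inr j) else MvPolynomial.X (.inl ⟨a, h⟩)

theorem polySubst_injective [Finite J] [Nonempty J] (i : I) :
    Function.Injective (polySubst k (J := J) i) := by
  classical
  obtain ⟨j₀⟩ := ‹Nonempty J›
  let r : MvPolynomial ({a : I // a ≠ i} ⊕ J) k →ₐ[k] MvPolynomial I k :=
    MvPolynomial.aeval (Sum.elim (fun a => MvPolynomial.X a.1)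
      (fun j => if j = j₀ then MvPolynomial.X i else 0))
  have h : r.comp (polySubst k (J := J) i) = AlgHom.id k _ := by
    cases nonempty_fintype J
    ext1 a
    by_cases ha : a = i
    · subst ha
      simp [r, polySubst, finsum_eq_sum_of_fintype]
    · simp [r, polySubst, ha]
  exact Function.LeftInverse.injective (g := r) fun p => DFunLike.congr_fun h p

/-- The substitution `f ↦ f |_{u_i = ∑_{j ∈ J} u_j}` on rational fractions. -/
noncomputable def subst [Finite J] [Nonempty J] (i : I) :
    Fractions k I →+* Fractions k ({a : I // a ≠ i} ⊕ J) :=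
  IsFractionRing.lift (A := MvPolynomial I k) (K := Fractions k I)
    (g := (algebraMap (MvPolynomial ({a : I // a ≠ i} ⊕ J) k)
      (Fractions k ({a : I // a ≠ i} ⊕ J))).comp (polySubst k (J := J) i).toRingHom)
    (by
      rw [RingHom.coe_comp]
      exact (IsFractionRing.injective _ _).comp (polySubst_injective k i))

/-- A fraction in the variables `u_j`, `j ∈ J`, seen among the fractions in the variables
labelled by `I \ {i} ⊔ J`. -/
noncomputable def incl (i : I) : Fractions k J →+* Fractions k ({a : I // a ≠ i} ⊕ J) :=
  IsFractionRing.lift (A := MvPolynomial J k) (K := Fractions k J)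
    (g := (algebraMap (MvPolynomial ({a : I // a ≠ i} ⊕ J) k)
      (Fractions k ({a : I // a ≠ i} ⊕ J))).comp (MvPolynomial.rename Sum.inr).toRingHom)
    (by
      rw [RingHom.coe_comp]
      exact (IsFractionRing.injective _ _).comp
        (MvPolynomial.rename_injective _ Sum.inr_injective))

end Fractions

/-- The operad of moulds over the field `k`: `Mould(I)` is the field of rational fractions in the
`u_i`, `i ∈ I`, and `f ∘_i g = (∑_{j ∈ J} u_j) * g * f |_{u_i = ∑_{j ∈ J} u_j}`. -/
noncomputable def Mould (k : Type*) [Field k] : OperadData where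
  obj := fun I => Fractions k I
  map := fun e f => Fractions.relabel k e f
  unit := (Fractions.u k ())⁻¹
  comp := fun {_ J} _ _ _ i f g =>
    (∑ᶠ j : J, Fractions.u k (.inr j)) * Fractions.incl k i g * Fractions.subst k i f

/-- The inclusion of the Zinbiel operad into the operad of moulds: the linear map sending a total
order `π` to `1 / ∏_i ∑_{j ≥ i} u_j`. -/
noncomputable def zinbToMould (k : Type*) [Field k] (I : Type) :
    (TotalOrder I →₀ k) →ₗ[k] Fractions k I :=
  Finsupp.linearCombination k fun π : TotalOrder I =>
    1 / ∏ᶠ i : I, ∑ᶠ (j : I) (_ : π.le i j), Fractions.u k j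

/-! ## The two morphisms on generators -/

/-- `γ` takes the value `[21]` on the rooted tree `[2 ◁ 1]` with root `2` and leaf `1`, and the
value `[12] + [21]` on the shrub `[1][2]` with two isolated vertices. -/
def HasZinbValues (k : Type*) [Field k] (γ : OperadHom Arb (Zinb k)) : Prop :=
  γ.toFun (Fin 2) Shrub.rootTwo = Finsupp.single (TotalOrder.decreasing 2) (1 : k) ∧
  γ.toFun (Fin 2) (Shrub.edgeless (Fin 2)) =
    (Finsupp.single (TotalOrder.increasing 2) 1 + Finsupp.single (TotalOrder.decreasing 2) 1 :
      TotalOrder (Fin 2) →₀ k)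

/-- `κ` takes the value `1 / (u₁ (u₁ + u₂))` on the rooted tree `[2 ◁ 1]` with root `2` and
leaf `1`, and the value `1 / (u₁ u₂)` on the shrub `[1][2]` with two isolated vertices. -/
def HasMouldValues (k : Type*) [Field k] (κ : OperadHom Arb (Mould k)) : Prop :=
  κ.toFun (Fin 2) Shrub.rootTwo =
    (1 / (Fractions.u k 0 * (Fractions.u k 0 + Fractions.u k 1)) : Fractions k (Fin 2)) ∧
  κ.toFun (Fin 2) (Shrub.edgeless (Fin 2)) =
    (1 / (Fractions.u k 0 * Fractions.u k 1) : Fractions k (Fin 2))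

/-!
Both morphisms are determined by their values on the two generators, because the two-vertex rooted
tree and the two-vertex edgeless shrub generate `Arb` (`OperadHom.arb_ext`). Indeed, the first
forbidden pattern makes the sets of vertices covered by the vertices of height one a laminar family,
and the second one makes all the vertices covered by a common vertex cover the same vertices. So, if
`a` is a vertex of height one covering an inclusion-maximal set, either the vertices all of whose
descending paths end in this set are not linked to the other ones, or this set contains all the
vertices of height zero, and the part of the shrub above the vertices of height one with this
property can be detached. In both cases the shrub is obtained by inserting two smaller shrubs in a
generator (`Shrub.exists_split`, `Shrub.exists_eq_relabel_comp`).

The morphism `γ` sends a shrub to the sum of the total orders in which every vertex of positive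
height comes after at least one of the vertices that it covers. It is a morphism because each total
order on `I \ {i} ⊔ J` occurs in exactly one composition of total orders
(`TotalOrder.isComposite_iff`) and compatibility with `P ∘_i Q` can be tested on the two factors
(`Shrub.isCompatible_comp_iff`). It is injective because the initial segments of the compatible
orders (the feasible sets) determine the shrub: the height of `j` is one less than the least
cardinality of a feasible set containing `j`, and `j` covers `i` when it can be added to a minimal
feasible set containing `i` and lies one step higher (`Shrub.eq_of_isCompatible_iff`).

For `κ`, the inclusion of `Zinb` into `Mould` has to be a morphism of operads, and injective. The
total orders occurring in `π ∘_i σ` are the linear extensions of a forest, so compatibility with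
compositions follows from the hook formula for linear extensions of forests
(`TotalOrder.sum_inv_hook_extensions`). Injectivity is proved by induction on the number of labels:
taking the residue at `u_m = 0` kills the total orders that do not end with `m`, and removes `m`
from the other ones (`isSpecialization_hook`, `zinbToMould_injective`). Hence `κ`, the composite of
`γ` with this inclusion, is injective too.
-/

/-! ### Decomposition of shrubs -/

namespace Shrub

variable {I : Type} (P : Shrub I)

/-- `P.Below v w`: there is a descending path of the shrub from `v` to `w`, each vertex covering
the next one. -/
def Below : I → I → Prop :=
  Relation.ReflTransGen (Covers P.graph P.height)

theorem Below.eq_or_height_lt {P : Shrub I} {v w : I} (h : P.Below v w) :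
    v = w ∨ P.height w < P.height v := by
  induction h with
  | refl => exact Or.inl rfl
  | tail _ hc ih =>
    right
    have := hc.2
    rcases ih with rfl | ih <;> omega

theorem covers_or_covers {v w : I} (h : P.graph.Adj v w) :
    Covers P.graph P.height v w ∨ Covers P.graph P.height w v := by
  rcases P.height_adj _ _ h with h' | h'
  · exact Or.inl ⟨h.symm, h'⟩
  · exact Or.inr ⟨h, h'⟩

theorem exists_height_eq_one {v : I} (hv : 0 < P.height v) : ∃ a, P.height a = 1 := by
  induction hn : P.height v generalizing v with
  | zero => omega
  | succ n ih =>
    obtain ⟨w, -, hw⟩ := P.exists_covered v hv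
    rcases Nat.eq_zero_or_pos (P.height w) with h0 | h0
    · exact ⟨v, by omega⟩
    · exact ih h0 (by omega)

/-- Two vertices covered by a common vertex cover the same vertices. -/
theorem covers_of_covers {a b c d : I} (hb : Covers P.graph P.height a b)
    (hc : Covers P.graph P.height a c) (hd : Covers P.graph P.height b d) :
    Covers P.graph P.height c d :=
  ⟨(P.four a b c d hb hc hd).symm, by have := hb.2; have := hc.2; have := hd.2; omega⟩

/-- The sets of vertices covered by the vertices of height one form a laminar family. Hence, when
the set covered by `a` is inclusion-maximal, the vertices whose descending paths all end in it
form a union of connected components. -/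
theorem adj_closed_of_maximal {a : I} (ha : P.height a = 1)
    (hmax : ∀ b, P.height b = 1 →
      (∀ w, Covers P.graph P.height a w → Covers P.graph P.height b w) →
      ∀ w, Covers P.graph P.height b w → Covers P.graph P.height a w)
    {v v' : I} (hv : ∀ w, P.height w = 0 → P.Below v w → Covers P.graph P.height a w)
    (hadj : P.graph.Adj v v') :
    ∀ w, P.height w = 0 → P.Below v' w → Covers P.graph P.height a w := by
  intro w hw hvw
  rcases P.covers_or_covers hadj with hc | hc
  · exact hv w hw (Relation.ReflTransGen.head hc hvw)
  · have hc2 := hc.2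
    obtain rfl | ⟨c, hvc, hcw⟩ := Relation.ReflTransGen.cases_head hvw
    · omega
    have hvc2 := hvc.2
    obtain rfl | ⟨e, hce, hew⟩ := Relation.ReflTransGen.cases_head hcw
    · -- `v'` has height one and shares the covered vertex `v` with `a`
      have hav := hv v (by omega) Relation.ReflTransGen.refl
      by_cases hsub : ∀ w, Covers P.graph P.height a w → Covers P.graph P.height v' w
      · exact hmax v' (by omega) hsub c hvc
      · push Not at hsub
        obtain ⟨x, hax, hvx⟩ := hsub
        rcases P.five a v' x v c hax hav hc hvc with h | h
        · exact ⟨h.symm, by omega⟩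
        · exact absurd ⟨h.symm, by have := hax.2; omega⟩ hvx
    · exact hv w hw (Relation.ReflTransGen.head (P.covers_of_covers hvc hc hce) hew)

/-- A shrub with at least two vertices splits into two parts, which either are not linked at all
or are linked exactly by joining all the vertices of height one of the upper part to all the
vertices of height zero. -/
theorem exists_split [Finite I] [Nontrivial I] :
    ∃ U : Set I, U.Nonempty ∧ Uᶜ.Nonempty ∧
      ((∀ u ∈ U, ∀ d ∉ U, ¬ P.graph.Adj u d) ∨
        ((∀ u ∈ U, 0 < P.height u) ∧
          ∀ u ∈ U, ∀ d ∉ U, P.graph.Adj u d ↔ P.height u = 1 ∧ P.height d = 0)) := by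
  by_cases hone : ∃ a, P.height a = 1
  swap
  · obtain ⟨a, b, hab⟩ := exists_pair_ne I
    refine ⟨{a}, ⟨a, rfl⟩, ⟨b, fun h => hab h.symm⟩, Or.inl fun u _ d _ h => ?_⟩
    have h0 : ∀ v, P.height v = 0 := fun v => by
      by_contra hv
      exact hone (P.exists_height_eq_one (Nat.pos_of_ne_zero hv))
    have := P.height_adj _ _ h
    have := h0 u
    have := h0 d
    omega
  obtain ⟨a, ha, hamax⟩ := Set.exists_max_image {a | P.height a = 1}
    (fun a => {w | Covers P.graph P.height a w}.ncard) (Set.toFinite _) hone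
  have hclosed := fun v v' => P.adj_closed_of_maximal (a := a) (v := v) (v' := v') ha
    (fun b hb hsub w hw => by
      have heq := Set.eq_of_subset_of_ncard_le (s := {w | Covers P.graph P.height a w})
        (t := {w | Covers P.graph P.height b w}) hsub (hamax b hb) (Set.toFinite _)
      exact Set.ext_iff.1 heq.symm w |>.1 hw)
  -- the vertices whose descending paths end in the set covered by `a`; no edge leaves `W`
  let W : Set I := {v | ∀ w, P.height w = 0 → P.Below v w → Covers P.graph P.height a w}
  have haW : a ∈ W := by
    intro w hw h
    obtain rfl | ⟨c, hac, hcw⟩ := Relation.ReflTransGen.cases_head h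
    · exact absurd (hw.symm.trans ha) zero_ne_one
    · rcases Below.eq_or_height_lt hcw with rfl | hlt
      · exact hac
      · have := hac.2
        have : P.height a = 1 := ha
        omega
  by_cases hW : Wᶜ.Nonempty
  · exact ⟨W, ⟨a, haW⟩, hW, Or.inl fun u hu d hd h => hd (hclosed u d hu h)⟩
  -- otherwise `a` covers all the vertices of height zero; the upper part `U` then consists of the
  -- vertices above some vertex with this property
  have hall : ∀ w, P.height w = 0 → Covers P.graph P.height a w := fun w hw =>
    (by_contra fun h => hW ⟨w, h⟩ : w ∈ W) w hw Relation.ReflTransGen.refl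
  let U : Set I := {v | ∃ b, (P.height b = 1 ∧ ∀ w, P.height w = 0 → Covers P.graph P.height b w) ∧
    P.Below v b}
  have hUpos : ∀ u ∈ U, 0 < P.height u := by
    rintro u ⟨b, ⟨hb, -⟩, hub⟩
    rcases Below.eq_or_height_lt hub with rfl | h <;> omega
  have hUnonempty : U.Nonempty := ⟨a, a, ⟨ha, hall⟩, Relation.ReflTransGen.refl⟩
  obtain ⟨z, hz⟩ := P.exists_height_zero
  refine ⟨U, hUnonempty, ⟨z, fun h => ?_⟩, Or.inr ⟨hUpos, ?_⟩⟩
  · have := hUpos z h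
    omega
  rintro u ⟨b, ⟨hb, hball⟩, hub⟩ d hd
  constructor
  · intro h
    rcases P.covers_or_covers h with hc | hc
    · obtain rfl | ⟨c, huc, hcb⟩ := Relation.ReflTransGen.cases_head hub
      · have := hc.2
        exact ⟨hb, by omega⟩
      · -- `d` and `c` are both covered by `u`, hence cover the same vertices
        refine absurd ?_ hd
        obtain rfl | ⟨e, hce, heb⟩ := Relation.ReflTransGen.cases_head hcb
        · exact ⟨d, ⟨by have := hc.2; have := huc.2; omega,
            fun w hw => P.covers_of_covers huc hc (hball w hw)⟩, Relation.ReflTransGen.refl⟩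
        · exact ⟨b, ⟨hb, hball⟩, Relation.ReflTransGen.head (P.covers_of_covers huc hc hce) heb⟩
    · exact absurd ⟨b, ⟨hb, hball⟩, Relation.ReflTransGen.head hc hub⟩ hd
  · rintro ⟨hu, hd0⟩
    rcases Below.eq_or_height_lt hub with rfl | h
    · exact (hball d hd0).1.symm
    · omega

/-- The shrub induced on a set `U` of vertices of height at least `n` that contains, with every
vertex of height more than `n`, all the vertices that it covers; heights are lowered by `n`. -/
def restrict (U : Set I) (n : ℕ) (hn : ∀ u ∈ U, n ≤ P.height u)
    (hU : ∀ u ∈ U, n < P.height u → ∀ v, Covers P.graph P.height u v → v ∈ U) : Shrub U where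
  graph := P.graph.comap Subtype.val
  height := fun u => P.height u - n
  height_adj := by
    rintro ⟨u, hu⟩ ⟨v, hv⟩ h
    have h1 := P.height_adj u v h
    have := hn u hu
    have := hn v hv
    change P.height u - n = P.height v - n + 1 ∨ P.height v - n = P.height u - n + 1
    omega
  exists_covered := by
    rintro ⟨u, hu⟩ h
    dsimp only at h
    obtain ⟨v, hv⟩ := P.exists_covered u (by omega)
    have hvU := hU u hu (by omega) v hv
    refine ⟨⟨v, hvU⟩, hv.1, ?_⟩
    have := hv.2
    have := hn v hvU
    simp only
    omega
  no_pattern_five := by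
    rintro ⟨a, b, c, d, e, h1, h2, h3, h4, h5, h6⟩
    have lift : ∀ {x y : U}, Covers (P.graph.comap Subtype.val) (fun u : U => P.height u - n) x y →
        Covers P.graph P.height x y := fun {x y} h =>
      ⟨h.1, by have := h.2; have := hn x x.2; have := hn y y.2; dsimp only at *; omega⟩
    exact P.no_pattern_five ⟨a, b, c, d, e, lift h1, lift h2, lift h3, lift h4, h5, h6⟩
  no_pattern_four := by
    rintro ⟨a, b, c, d, h1, h2, h3, h4⟩
    have lift : ∀ {x y : U}, Covers (P.graph.comap Subtype.val) (fun u : U => P.height u - n) x y →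
        Covers P.graph P.height x y := fun {x y} h =>
      ⟨h.1, by have := h.2; have := hn x x.2; have := hn y y.2; dsimp only at *; omega⟩
    exact P.no_pattern_four ⟨a, b, c, d, lift h1, lift h2, lift h3, h4⟩

theorem relabel_eq_of_iso {J : Type} {P : Shrub I} {Q : Shrub J} (e : I ≃ J)
    (hg : ∀ a b, P.graph.Adj a b ↔ Q.graph.Adj (e a) (e b))
    (hh : ∀ a, P.height a = Q.height (e a)) : P.relabel e = Q := by
  ext a
  · simp [relabel, hg]
  · simp [relabel, hh]

/-- The label set of `(X ∘₀ A) ∘₁ B`, for `X` on `{0, 1}`, is the disjoint union of those of `A`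
and `B`; here these are complementary subsets. -/
def splitEquiv (U : Set I) [DecidablePred (· ∈ U)] :
    ({b : {a : Fin 2 // a ≠ 0} ⊕ U // b ≠ Sum.inl ⟨1, one_ne_zero⟩} ⊕ (Uᶜ : Set I)) ≃ I where
  toFun
    | .inl ⟨.inr u, _⟩ => u
    | .inl ⟨.inl a, h⟩ => absurd (by obtain ⟨a, ha⟩ := a; simp; omega) h
    | .inr d => d
  invFun := fun x => if hx : x ∈ U then .inl ⟨.inr ⟨x, hx⟩, by simp⟩ else .inr ⟨x, hx⟩
  left_inv := by
    rintro (⟨a | u, h⟩ | d)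
    · exact absurd (by obtain ⟨a, ha⟩ := a; simp; omega) h
    · simp
    · have hd : ¬ (d : I) ∈ U := d.2
      simp [hd]
  right_inv := by
    intro x
    dsimp only
    split_ifs <;> rfl

/-- Every shrub with at least two vertices is obtained from one of the two generators by inserting
shrubs with fewer vertices at its two vertices. -/
theorem exists_eq_relabel_comp [Finite I] [Nontrivial I] :
    ∃ (U : Set I) (X : Shrub (Fin 2)) (A : Shrub U) (B : Shrub (Uᶜ : Set I))
      (_ : Nonempty U) (_ : Nonempty (Uᶜ : Set I))
      (e : ({b : {a : Fin 2 // a ≠ 0} ⊕ U // b ≠ Sum.inl ⟨1, one_ne_zero⟩} ⊕ (Uᶜ : Set I)) ≃ I),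
      (X = rootTwo ∨ X = edgeless (Fin 2)) ∧
      (comp (Sum.inl ⟨1, one_ne_zero⟩) (comp 0 X A) B).relabel e = P := by
  classical
  obtain ⟨U, hU, hUc, h⟩ := P.exists_split
  have := hU.to_subtype
  have := hUc.to_subtype
  rcases h with h | ⟨hpos, h⟩
  · refine ⟨U, edgeless (Fin 2), P.restrict U 0 (by simp) ?_, P.restrict Uᶜ 0 (by simp) ?_,
      ‹_›, ‹_›, splitEquiv U, Or.inr rfl, relabel_eq_of_iso _ ?_ ?_⟩
    · exact fun u hu _ v hv => by_contra fun hv' => h u hu v hv' hv.1.symm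
    · exact fun u hu _ v hv hv' => h v hv' u hu hv.1
    · rintro (⟨a | u, ha⟩ | d) (⟨b | u', hb⟩ | d')
      all_goals try exact absurd (by obtain ⟨a, ha⟩ := a; simp; omega) ha
      all_goals try exact absurd (by obtain ⟨b, hb⟩ := b; simp; omega) hb
      · rfl
      · simpa [comp, compGraph, compAdj, edgeless, splitEquiv] using h u u.2 d' d'.2
      · simpa [comp, compGraph, compAdj, edgeless, splitEquiv, SimpleGraph.adj_comm] using
          h u' u'.2 d d.2
      · rfl
    · rintro (⟨a | u, ha⟩ | d)
      · exact absurd (by obtain ⟨a, ha⟩ := a; simp; omega) ha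
      · simp [comp, compHeight, edgeless, splitEquiv, restrict]
      · simp [comp, compHeight, edgeless, splitEquiv, restrict]
  · refine ⟨U, rootTwo, P.restrict U 1 hpos ?_, P.restrict Uᶜ 0 (by simp) ?_,
      ‹_›, ‹_›, splitEquiv U, Or.inl rfl, relabel_eq_of_iso _ ?_ ?_⟩
    · intro u hu h1 v hv
      by_contra hv'
      have := (h u hu v hv').1 hv.1.symm
      omega
    · intro u hu _ v hv hv'
      have := (h v hv' u hu).1 hv.1
      have := hv.2
      omega
    · rintro (⟨a | u, ha⟩ | d) (⟨b | u', hb⟩ | d')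
      all_goals try exact absurd (by obtain ⟨a, ha⟩ := a; simp; omega) ha
      all_goals try exact absurd (by obtain ⟨b, hb⟩ := b; simp; omega) hb
      · rfl
      · have := hpos u u.2
        have := h u u.2 d' d'.2
        simp [comp, compGraph, compAdj, rootTwo, splitEquiv, restrict, this]
        omega
      · have := hpos u' u'.2
        have := h u' u'.2 d d.2
        simp [comp, compGraph, compAdj, rootTwo, splitEquiv, restrict, this,
          P.graph.adj_comm d]
        omega
      · rfl
    · rintro (⟨a | u, ha⟩ | d)
      · exact absurd (by obtain ⟨a, ha⟩ := a; simp; omega) ha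
      · have := hpos u u.2
        simp [comp, compHeight, rootTwo, splitEquiv, restrict]
        omega
      · simp [comp, compHeight, rootTwo, splitEquiv, restrict]

end Shrub

/-- `Arb` is generated by the rooted tree with two vertices and the edgeless shrub with two
vertices. -/
theorem OperadHom.arb_ext {O : OperadData} {f g : OperadHom Arb O}
    (hroot : f.toFun (Fin 2) Shrub.rootTwo = g.toFun (Fin 2) Shrub.rootTwo)
    (hedgeless : f.toFun (Fin 2) (Shrub.edgeless (Fin 2)) =
      g.toFun (Fin 2) (Shrub.edgeless (Fin 2))) : f = g := by
  suffices h : ∀ (n : ℕ) (I : Type) [Finite I] [Nonempty I], Nat.card I = n →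
      ∀ P : Shrub I, f.toFun I P = g.toFun I P by
    ext I _ _ P
    exact h _ I rfl P
  intro n
  induction n using Nat.strong_induction_on with
  | _ n ih =>
    intro I _ _ hI P
    rcases subsingleton_or_nontrivial I with _ | _
    · obtain ⟨x⟩ := ‹Nonempty I›
      have : Unique I := ⟨⟨x⟩, fun _ => Subsingleton.elim _ _⟩
      have hP : Arb.map (Equiv.ofUnique Unit I) Arb.unit = P := by
        refine Shrub.relabel_eq_of_iso _ (fun a b => ?_) (fun a => ?_)
        · rw [Subsingleton.elim a b]
          simp
        · obtain ⟨z, hz⟩ := P.exists_height_zero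
          rw [Subsingleton.elim (Equiv.ofUnique Unit I a) z, hz]
          rfl
      rw [← hP, f.map_relabel, g.map_relabel, f.map_unit, g.map_unit]
    · obtain ⟨U, X, A, B, hU, hUc, e, hX, hP⟩ := P.exists_eq_relabel_comp
      have hcard : Nat.card U + Nat.card (Uᶜ : Set I) = n := by
        rw [← hI]
        exact Set.ncard_add_ncard_compl U
      have hUpos : 0 < Nat.card U := Nat.card_pos
      have hUcpos : 0 < Nat.card (Uᶜ : Set I) := Nat.card_pos
      have hA := ih _ (by omega) U rfl A
      have hB := ih _ (by omega) (Uᶜ : Set I) rfl B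
      have hX' : f.toFun (Fin 2) X = g.toFun (Fin 2) X := by
        rcases hX with rfl | rfl <;> assumption
      have key : ∀ {I J : Type} [Finite I] [Nonempty I] [Finite J] [Nonempty J] (i : I)
          (x : Arb.obj I) (y : Arb.obj J), f.toFun I x = g.toFun I x → f.toFun J y = g.toFun J y →
          f.toFun _ (Arb.comp i x y) = g.toFun _ (Arb.comp i x y) := by
        intro I J _ _ _ _ i x y hx hy
        rw [f.map_comp, g.map_comp, hx, hy]
      have hP' := (f.map_relabel e _).trans ((congrArg (O.map e)
        (key (Sum.inl ⟨1, one_ne_zero⟩) _ B (key (0 : Fin 2) X A hX' hA) hB)).trans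
        (g.map_relabel e _).symm)
      exact hP ▸ hP'

/-! ### Total orders and the composition of the Zinbiel operad -/

namespace TotalOrder

variable {I J : Type}

/-- The total order on `I` induced by a total order on `J` along an injective map. -/
def comap (f : I → J) (hf : Function.Injective f) (τ : TotalOrder J) : TotalOrder I where
  le := fun a b => τ.le (f a) (f b)
  refl := fun _ => τ.refl _
  trans := fun _ _ _ => τ.trans _ _ _
  antisymm := fun _ _ h h' => hf (τ.antisymm _ _ h h')
  total := fun _ _ => τ.total _ _

theorem eq_of_le {π τ : TotalOrder I} (h : ∀ a b, π.le a b → τ.le a b) : π = τ := by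
  ext a b
  refine ⟨h a b, fun hab => ?_⟩
  rcases π.total a b with h' | h'
  · exact h'
  · rw [τ.antisymm a b hab (h b a h')]
    exact π.refl b

theorem exists_bot [Finite I] [Nonempty I] (τ : TotalOrder I) : ∃ m, ∀ c, τ.le m c := by
  classical
  let _ : LinearOrder I :=
    { le := τ.le
      le_refl := τ.refl
      le_trans := τ.trans
      le_antisymm := τ.antisymm
      le_total := τ.total
      toDecidableLE := Classical.decRel _ }
  exact Finite.exists_min (id : I → I)

/-- The total order opposite to `τ`. -/
def opposite (τ : TotalOrder I) : TotalOrder I where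
  le := fun a b => τ.le b a
  refl := τ.refl
  trans := fun _ _ _ h h' => τ.trans _ _ _ h' h
  antisymm := fun _ _ h h' => τ.antisymm _ _ h' h
  total := fun a b => τ.total b a

theorem exists_top [Finite I] [Nonempty I] (τ : TotalOrder I) : ∃ m, ∀ c, τ.le c m :=
  τ.opposite.exists_bot

/-- The first element of a total order. -/
noncomputable def bot [Finite I] [Nonempty I] (τ : TotalOrder I) : I :=
  τ.exists_bot.choose

theorem bot_le [Finite I] [Nonempty I] (τ : TotalOrder I) (c : I) : τ.le τ.bot c :=
  τ.exists_bot.choose_spec c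

theorem eq_bot [Finite I] [Nonempty I] {τ : TotalOrder I} {m : I} (h : ∀ c, τ.le m c) :
    m = τ.bot :=
  τ.antisymm _ _ (h _) (τ.bot_le _)

variable [Finite J] [Nonempty J] (i : I) (τ : TotalOrder ({a : I // a ≠ i} ⊕ J))

/-- The total order induced on `J` by a total order on `I \ {i} ⊔ J`. -/
def inner : TotalOrder J :=
  τ.comap Sum.inr Sum.inr_injective

open Classical in
/-- The total order on `I` obtained from a total order on `I \ {i} ⊔ J` by putting `i` in the place
of the first element of `J` and forgetting the other elements of `J`. -/
noncomputable def outer : TotalOrder I :=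
  τ.comap (fun a => if h : a = i then Sum.inr (τ.inner i).bot else Sum.inl ⟨a, h⟩) (by
    intro a b h
    dsimp only at h
    split_ifs at h with ha hb hb
    · rw [ha, hb]
    · simpa using h)

variable {i} {τ}

theorem outer_le_of_ne {a b : I} (ha : a ≠ i) (hb : b ≠ i) :
    (τ.outer i).le a b ↔ τ.le (.inl ⟨a, ha⟩) (.inl ⟨b, hb⟩) := by
  simp [outer, comap, ha, hb]

theorem outer_le_right {a : I} (ha : a ≠ i) :
    (τ.outer i).le a i ↔ τ.le (.inl ⟨a, ha⟩) (.inr (τ.inner i).bot) := by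
  simp [outer, comap, ha]

theorem outer_le_left {a : I} (ha : a ≠ i) :
    (τ.outer i).le i a ↔ τ.le (.inr (τ.inner i).bot) (.inl ⟨a, ha⟩) := by
  simp [outer, comap, ha]

/-- A total order on `I \ {i} ⊔ J` occurs in exactly one composition of total orders. -/
theorem isComposite_iff {π : TotalOrder I} {σ : TotalOrder J} :
    IsComposite i π σ τ ↔ π = τ.outer i ∧ σ = τ.inner i := by
  constructor
  · rintro ⟨h1, h2, h3, h4⟩
    have hσ : σ = τ.inner i := eq_of_le h2
    refine ⟨eq_of_le fun a b hab => ?_, hσ⟩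
    by_cases ha : a = i
    · subst ha
      by_cases hb : b = a
      · subst hb
        exact refl _ _
      · rw [outer_le_left hb]
        exact h4 _ _ (fun c => hσ ▸ bot_le _ c) hab
    · by_cases hb : b = i
      · subst hb
        rw [outer_le_right ha]
        exact h3 _ _ hab
      · rw [outer_le_of_ne ha hb]
        exact h1 _ _ hab
  · rintro ⟨rfl, rfl⟩
    refine ⟨fun a b => (outer_le_of_ne a.2 b.2).1, fun a b => id, fun a b h => ?_,
      fun a b hb h => ?_⟩
    · exact τ.trans _ _ _ ((outer_le_right a.2).1 h) ((τ.inner i).bot_le b)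
    · rw [eq_bot hb]
      exact (outer_le_left a.2).1 h

end TotalOrder

theorem zinbBasisComp_apply (k : Type*) [Field k] {I J : Type} [Finite I] [Finite J] (i : I)
    (π : TotalOrder I) (σ : TotalOrder J) (τ : TotalOrder ({a : I // a ≠ i} ⊕ J))
    [Decidable (π.IsComposite i σ τ)] :
    zinbBasisComp k i π σ τ = if π.IsComposite i σ τ then 1 else 0 := by
  classical
  let _ := Fintype.ofFinite (TotalOrder ({a : I // a ≠ i} ⊕ J))
  simp [zinbBasisComp, Finsupp.finsetSum_apply, Finsupp.single_apply, Finset.sum_ite_eq']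

/-- In coordinates, the composition of the Zinbiel operad is a product of pullbacks. -/
theorem zinb_comp_apply (k : Type*) [Field k] {I J : Type} [Finite I] [Finite J] [Nonempty J]
    (i : I) (x : TotalOrder I →₀ k) (y : TotalOrder J →₀ k)
    (τ : TotalOrder ({a : I // a ≠ i} ⊕ J)) :
    DFunLike.coe (F := TotalOrder ({a : I // a ≠ i} ⊕ J) →₀ k) ((Zinb k).comp i x y) τ =
      x (τ.outer i) * y (τ.inner i) := by
  classical
  change (x.sum fun π a => y.sum fun σ b => (a * b) • zinbBasisComp k i π σ) τ = _
  simp only [Finsupp.sum, Finsupp.finsetSum_apply, Finsupp.smul_apply, zinbBasisComp_apply,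
    TotalOrder.isComposite_iff, smul_eq_mul, mul_ite, mul_one, mul_zero]
  by_cases hx : x (τ.outer i) = 0
  · rw [hx, zero_mul]
    refine Finset.sum_eq_zero fun π _ => Finset.sum_eq_zero fun σ _ => ?_
    split_ifs with h
    · rw [h.1, hx, zero_mul]
    · rfl
  by_cases hy : y (τ.inner i) = 0
  · rw [hy, mul_zero]
    refine Finset.sum_eq_zero fun π _ => Finset.sum_eq_zero fun σ _ => ?_
    split_ifs with h
    · rw [h.2, hy, mul_zero]
    · rfl
  rw [Finset.sum_eq_single (τ.outer i), Finset.sum_eq_single (τ.inner i)]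
  · simp
  · intro σ _ h
    simp [h]
  · intro h
    exact absurd (Finsupp.mem_support_iff.2 hy) h
  · intro π _ h
    simp [h]
  · intro h
    exact absurd (Finsupp.mem_support_iff.2 hx) h

theorem zinb_map_apply (k : Type*) [Field k] {I J : Type} (e : I ≃ J) (x : TotalOrder I →₀ k)
    (τ : TotalOrder J) :
    DFunLike.coe (F := TotalOrder J →₀ k) ((Zinb k).map e x) τ = x (τ.relabel e.symm) := by
  have hinj : Function.Injective (TotalOrder.relabel e) := by
    intro π π' h
    ext a b
    have := congrArg (fun ρ : TotalOrder J => ρ.le (e a) (e b)) h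
    simpa [TotalOrder.relabel] using this
  have hτ : τ = (τ.relabel e.symm).relabel e := by
    ext a b
    simp [TotalOrder.relabel]
  change x.mapDomain (TotalOrder.relabel e) τ = _
  conv_lhs => rw [hτ]
  exact Finsupp.mapDomain_apply hinj _ _

theorem TotalOrder.eq_increasing_or_decreasing (τ : TotalOrder (Fin 2)) :
    τ = increasing 2 ∨ τ = decreasing 2 := by
  rcases τ.total 0 1 with h | h
  · refine Or.inl (eq_of_le ?_).symm
    intro a b hab
    fin_cases a <;> fin_cases b
    exacts [τ.refl _, h, absurd hab (by simp [increasing]), τ.refl _]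
  · refine Or.inr (eq_of_le ?_).symm
    intro a b hab
    fin_cases a <;> fin_cases b
    exacts [τ.refl _, absurd hab (by simp [decreasing]), h, τ.refl _]

theorem TotalOrder.increasing_ne_decreasing : increasing 2 ≠ decreasing 2 := by
  intro h
  have := congrArg (fun τ : TotalOrder (Fin 2) => τ.le 0 1) h
  simp [increasing, decreasing] at this

/-! ### The morphism from shrubs to the Zinbiel operad -/

namespace Shrub

variable {I J : Type}

/-- A total order is compatible with a shrub if every vertex of positive height comes after at
least one of the vertices that it covers. -/
def IsCompatible (P : Shrub I) (τ : TotalOrder I) : Prop :=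
  ∀ j, 0 < P.height j → ∃ i, Covers P.graph P.height j i ∧ τ.le i j

theorem isCompatible_comp_iff [Finite J] [Nonempty J] (i : I) (P : Shrub I) (Q : Shrub J)
    (τ : TotalOrder ({a : I // a ≠ i} ⊕ J)) :
    (comp i P Q).IsCompatible τ ↔ P.IsCompatible (τ.outer i) ∧ Q.IsCompatible (τ.inner i) := by
  -- for a compatible order on `J`, the first element has height zero
  have hbot : ∀ σ : TotalOrder J, Q.IsCompatible σ → Q.height σ.bot = 0 := by
    intro σ h
    by_contra h0
    obtain ⟨b, hb, hle⟩ := h _ (Nat.pos_of_ne_zero h0)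
    exact hb.1.ne (σ.antisymm _ _ hle (σ.bot_le b))
  constructor
  · intro h
    have hQ : Q.IsCompatible (τ.inner i) := by
      intro j hj
      obtain ⟨a | b, ⟨h1, h2⟩, h3⟩ := h (.inr j) (by simp only [comp, compHeight]; omega)
      · exact absurd h1.2 hj.ne'
      · exact ⟨b, ⟨h1, by simpa [comp, compHeight, add_right_comm] using h2⟩, h3⟩
    refine ⟨fun j hj => ?_, hQ⟩
    by_cases hji : j = i
    · subst hji
      obtain ⟨a | b, ⟨h1, h2⟩, h3⟩ := h (.inr (τ.inner j).bot)
        (by simp only [comp, compHeight]; omega)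
      · refine ⟨a, ⟨h1.1, ?_⟩, (TotalOrder.outer_le_right a.2).2 h3⟩
        have := hbot _ hQ
        simp only [comp, compHeight] at h2
        omega
      · have := hbot _ hQ
        simp only [comp, compHeight] at h2
        omega
    · obtain ⟨a | b, ⟨h1, h2⟩, h3⟩ := h (.inl ⟨j, hji⟩) hj
      · exact ⟨a, ⟨h1, h2⟩, (TotalOrder.outer_le_of_ne a.2 hji).2 h3⟩
      · refine ⟨i, ⟨SimpleGraph.Adj.symm (G := P.graph) h1.1, ?_⟩,
          (TotalOrder.outer_le_left hji).2 (τ.trans _ _ _ ((τ.inner i).bot_le b) h3)⟩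
        have := h1.2
        simp only [comp, compHeight] at h2
        omega
  · rintro ⟨hP, hQ⟩ (j | j) hj
    · obtain ⟨a, ⟨h1, h2⟩, h3⟩ := hP j hj
      by_cases hai : a = i
      · subst hai
        refine ⟨.inr (τ.inner a).bot, ⟨⟨h1.symm, hbot _ hQ⟩, ?_⟩,
          (TotalOrder.outer_le_left j.2).1 h3⟩
        simp [comp, compHeight, hbot _ hQ, h2]
      · exact ⟨.inl ⟨a, hai⟩, ⟨h1, h2⟩, (TotalOrder.outer_le_of_ne hai j.2).1 h3⟩
    · rcases Nat.eq_zero_or_pos (Q.height j) with h0 | hpos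
      · simp only [comp, compHeight, h0, zero_add] at hj
        obtain ⟨a, ⟨h1, h2⟩, h3⟩ := hP i hj
        refine ⟨.inl ⟨a, h1.ne⟩, ⟨⟨h1, h0⟩, by simp [comp, compHeight, h0, h2]⟩, ?_⟩
        exact τ.trans _ _ _ ((TotalOrder.outer_le_right h1.ne).1 h3) ((τ.inner i).bot_le j)
      · obtain ⟨b, ⟨h1, h2⟩, h3⟩ := hQ j hpos
        exact ⟨.inr b, ⟨h1, by simp [comp, compHeight, h2, add_right_comm]⟩, h3⟩

theorem isCompatible_relabel_iff (e : I ≃ J) (P : Shrub I) (τ : TotalOrder J) :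
    (P.relabel e).IsCompatible τ ↔ P.IsCompatible (τ.relabel e.symm) := by
  simp [IsCompatible, relabel, TotalOrder.relabel, e.forall_congr_left, e.exists_congr_left, Covers]

/-- The sets of vertices that contain, with each vertex of positive height, at least one of the
vertices that it covers. They are the initial segments of the compatible total orders. -/
def IsFeasible (P : Shrub I) (S : Set I) : Prop :=
  ∀ j ∈ S, 0 < P.height j → ∃ i ∈ S, Covers P.graph P.height j i

theorem isFeasible_iff_exists_isCompatible [Finite I] (P : Shrub I) (S : Set I) :
    P.IsFeasible S ↔ ∃ τ, P.IsCompatible τ ∧ ∀ i ∈ S, ∀ j ∉ S, ¬ τ.le j i := by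
  classical
  constructor
  · -- list the elements of `S` before the others, both by increasing height
    intro hS
    obtain ⟨n, ⟨e⟩⟩ := Finite.exists_equiv_fin I
    let key : I → ℕ ×ₗ ℕ ×ₗ Fin n :=
      fun i => toLex (if i ∈ S then 0 else 1, toLex (P.height i, e i))
    have hkey : Function.Injective key := by
      intro a b h
      simp only [key, EmbeddingLike.apply_eq_iff_eq, Prod.mk.injEq] at h
      exact h.2.2
    let τ : TotalOrder I :=
      { le := fun a b => key a ≤ key b
        refl := fun a => le_refl (key a)
        trans := fun a b c => le_trans (a := key a) (b := key b) (c := key c)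
        antisymm := fun a b h h' => hkey (le_antisymm h h')
        total := fun a b => le_total (key a) (key b) }
    refine ⟨τ, fun j hj => ?_, fun i hi j hj h => ?_⟩
    · by_cases hjS : j ∈ S
      · obtain ⟨i, hi, hc⟩ := hS j hjS hj
        refine ⟨i, hc, ?_⟩
        have := hc.2
        change key i ≤ key j
        simp [key, Prod.Lex.le_iff, hi, hjS]
        omega
      · obtain ⟨i, hc⟩ := P.exists_covered j hj
        refine ⟨i, hc, ?_⟩
        have := hc.2
        change key i ≤ key j
        by_cases hi : i ∈ S
        · simp [key, Prod.Lex.le_iff, hi, hjS]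
        · simp [key, Prod.Lex.le_iff, hi, hjS]
          omega
    · change key j ≤ key i at h
      simp [key, Prod.Lex.le_iff, hi, hj] at h
  · rintro ⟨τ, hτ, hS⟩ j hj hpos
    obtain ⟨i, hc, hle⟩ := hτ j hpos
    exact ⟨i, by_contra fun hi => hS j hj i hi hle, hc⟩

/-- A feasible set containing `j` contains vertices of all heights up to that of `j`. -/
theorem IsFeasible.height_lt_ncard [Finite I] {P : Shrub I} {S : Set I} (hS : P.IsFeasible S)
    {j : I} (hj : j ∈ S) : P.height j < S.ncard := by
  have h : ∀ n, ∀ j ∈ S, P.height j = n → ∀ m ≤ n, m ∈ P.height '' S := by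
    intro n
    induction n with
    | zero => exact fun j hj hn m hm => ⟨j, hj, by omega⟩
    | succ n ih =>
      intro j hj hn m hm
      obtain ⟨i, hi, hc⟩ := hS j hj (by omega)
      have := hc.2
      rcases Nat.lt_or_ge n m with h' | h'
      · exact ⟨j, hj, by omega⟩
      · exact ih i hi (by omega) m h'
  have hsub : (Finset.range (P.height j + 1) : Set ℕ) ⊆ P.height '' S := by
    intro m hm
    exact h _ j hj rfl m (by simpa [Nat.lt_succ_iff] using hm)
  have h1 := Set.ncard_le_ncard hsub (Set.toFinite _)
  have h2 := Set.ncard_image_le (f := P.height) (Set.toFinite S)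
  rw [Set.ncard_coe_finset, Finset.card_range] at h1
  omega

/-- A descending chain from `j` is a feasible set of the least possible cardinality. -/
theorem exists_isFeasible_chain [Finite I] (P : Shrub I) (j : I) :
    ∃ S, P.IsFeasible S ∧ j ∈ S ∧ S.ncard = P.height j + 1 ∧
      ∀ i ∈ S, i = j ∨ P.height i < P.height j := by
  induction hn : P.height j generalizing j with
  | zero =>
    refine ⟨{j}, ?_, rfl, by simp, fun i hi => Or.inl hi⟩
    rintro i rfl hi
    omega
  | succ n ih =>
    obtain ⟨i, hc⟩ := P.exists_covered j (by omega)
    have hc2 := hc.2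
    obtain ⟨S, hS, hiS, hcard, hlt⟩ := ih i (by omega)
    have hjS : j ∉ S := by
      intro h
      rcases hlt j h with rfl | h' <;> omega
    refine ⟨insert j S, ?_, Set.mem_insert _ _, ?_, ?_⟩
    · rintro a (rfl | ha) hpos
      · exact ⟨i, Set.mem_insert_of_mem _ hiS, hc⟩
      · obtain ⟨b, hb, hab⟩ := hS a ha hpos
        exact ⟨b, Set.mem_insert_of_mem _ hb, hab⟩
    · rw [Set.ncard_insert_of_notMem hjS (Set.toFinite _), hcard]
    · rintro a (rfl | ha)
      · exact Or.inl rfl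
      · rcases hlt a ha with rfl | h' <;> exact Or.inr (by omega)

theorem height_le_of_isFeasible [Finite I] {P Q : Shrub I}
    (h : ∀ S, P.IsFeasible S → Q.IsFeasible S) (j : I) : Q.height j ≤ P.height j := by
  obtain ⟨S, hS, hj, hcard, -⟩ := P.exists_isFeasible_chain j
  have := (h S hS).height_lt_ncard hj
  omega

theorem covers_of_isFeasible [Finite I] {P Q : Shrub I}
    (h : ∀ S, P.IsFeasible S → Q.IsFeasible S) (hheight : P.height = Q.height) {i j : I}
    (hc : Covers P.graph P.height j i) : Covers Q.graph Q.height j i := by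
  -- `j` can be added to a chain below `i` only because it covers `i`
  obtain ⟨S, hS, hi, -, hlt⟩ := P.exists_isFeasible_chain i
  have hc2 := hc.2
  have hfeas : P.IsFeasible (insert j S) := by
    rintro a (rfl | ha) hpos
    · exact ⟨i, Set.mem_insert_of_mem _ hi, hc⟩
    · obtain ⟨b, hb, hab⟩ := hS a ha hpos
      exact ⟨b, Set.mem_insert_of_mem _ hb, hab⟩
  obtain ⟨b, hb, hjb⟩ := h _ hfeas j (Set.mem_insert _ _) (by rw [← hheight]; omega)
  have hjb2 := hjb.2
  rw [← hheight] at hjb2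
  rcases hb with rfl | hb
  · omega
  · rcases hlt b hb with rfl | h'
    · exact hjb
    · omega

/-- A shrub is determined by its compatible total orders. -/
theorem eq_of_isCompatible_iff [Finite I] {P Q : Shrub I}
    (h : ∀ τ, P.IsCompatible τ ↔ Q.IsCompatible τ) : P = Q := by
  have hF : ∀ S, P.IsFeasible S ↔ Q.IsFeasible S := by
    simp only [isFeasible_iff_exists_isCompatible, h, implies_true]
  have hheight : P.height = Q.height := funext fun j =>
    le_antisymm (height_le_of_isFeasible (fun S => (hF S).2) j)
      (height_le_of_isFeasible (fun S => (hF S).1) j)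
  have hPQ := fun i j => covers_of_isFeasible (fun S => (hF S).1) hheight (i := i) (j := j)
  have hQP := fun i j => covers_of_isFeasible (fun S => (hF S).2) hheight.symm (i := i) (j := j)
  refine Shrub.ext ?_ hheight
  ext a b
  constructor
  · intro hab
    rcases P.covers_or_covers hab with hc | hc
    · exact (hPQ _ _ hc).1.symm
    · exact (hPQ _ _ hc).1
  · intro hab
    rcases Q.covers_or_covers hab with hc | hc
    · exact (hQP _ _ hc).1.symm
    · exact (hQP _ _ hc).1

open Classical in
/-- The sum of the total orders compatible with a shrub. -/
noncomputable def toZinb (k : Type*) [Field k] [Finite I] (P : Shrub I) : TotalOrder I →₀ k :=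
  Finsupp.equivFunOnFinite.symm fun τ => if P.IsCompatible τ then 1 else 0

open Classical in
theorem toZinb_apply (k : Type*) [Field k] [Finite I] (P : Shrub I) (τ : TotalOrder I) :
    P.toZinb k τ = if P.IsCompatible τ then 1 else 0 :=
  rfl

theorem toZinb_comp_apply (k : Type*) [Field k] [Finite I] [Finite J] [Nonempty J] (i : I)
    (P : Shrub I) (Q : Shrub J) (τ : TotalOrder ({a : I // a ≠ i} ⊕ J)) :
    (comp i P Q).toZinb k τ = P.toZinb k (τ.outer i) * Q.toZinb k (τ.inner i) := by
  classical
  rw [toZinb_apply, toZinb_apply, toZinb_apply, ite_zero_mul_ite_zero, mul_one]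
  exact if_congr (isCompatible_comp_iff i P Q τ) rfl rfl

theorem toZinb_injective (k : Type*) [Field k] [Finite I] :
    Function.Injective (toZinb k : Shrub I → TotalOrder I →₀ k) := by
  intro P Q h
  refine eq_of_isCompatible_iff fun τ => ?_
  have := DFunLike.congr_fun h τ
  rw [toZinb_apply, toZinb_apply] at this
  split_ifs at this with hP hQ hQ
  · exact iff_of_true hP hQ
  · exact absurd this one_ne_zero
  · exact absurd this.symm one_ne_zero
  · exact iff_of_false hP hQ

end Shrub

/-- The morphism of operads sending a shrub to the sum of its compatible total orders. -/
noncomputable def arbToZinb (k : Type*) [Field k] : OperadHom Arb (Zinb k) where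
  toFun := fun _ _ _ P => Shrub.toZinb k P
  map_relabel := by
    classical
    intro I J _ _ _ _ e P
    refine Finsupp.ext fun τ => ?_
    refine Eq.trans ?_ (zinb_map_apply k e (P.toZinb k) τ).symm
    exact if_congr (Shrub.isCompatible_relabel_iff e P τ) rfl rfl
  map_unit := by
    classical
    refine Finsupp.ext fun τ => ?_
    have hτ : τ = TotalOrder.point := by
      ext a b
      exact iff_of_true (τ.refl _) trivial
    subst hτ
    refine Eq.trans (if_pos ?_) (Finsupp.single_eq_same).symm
    intro j hj
    exact absurd hj (lt_irrefl 0)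
  map_comp := by
    intro I J _ _ _ _ i P Q
    refine Finsupp.ext fun τ => ?_
    exact (Shrub.toZinb_comp_apply k i P Q τ).trans
      (zinb_comp_apply k i (P.toZinb k) (Q.toZinb k) τ).symm

theorem hasZinbValues_arbToZinb (k : Type*) [Field k] : HasZinbValues k (arbToZinb k) := by
  classical
  have hne := TotalOrder.increasing_ne_decreasing
  have hinc : ¬ Shrub.rootTwo.IsCompatible (TotalOrder.increasing 2) := by
    intro h
    obtain ⟨i, hc, hle⟩ := h 0 (by simp [Shrub.rootTwo])
    obtain rfl : i = 0 := by simpa [TotalOrder.increasing] using hle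
    exact hc.1.ne rfl
  have hdec : Shrub.rootTwo.IsCompatible (TotalOrder.decreasing 2) := by
    intro j hj
    fin_cases j
    · exact ⟨1, by simp [Covers, Shrub.rootTwo], by simp [TotalOrder.decreasing]⟩
    · simp [Shrub.rootTwo] at hj
  have hedge : ∀ τ, (Shrub.edgeless (Fin 2)).IsCompatible τ := fun τ j hj =>
    absurd hj (lt_irrefl 0)
  constructor <;> refine Finsupp.ext fun τ => ?_
  · change Shrub.toZinb k Shrub.rootTwo τ = _
    rcases τ.eq_increasing_or_decreasing with rfl | rfl
    · simp [Shrub.toZinb_apply, hinc, hne]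
    · simp [Shrub.toZinb_apply, hdec]
  · change Shrub.toZinb k (Shrub.edgeless (Fin 2)) τ = _
    rcases τ.eq_increasing_or_decreasing with rfl | rfl
    · simp [Shrub.toZinb_apply, hedge, hne]
    · simp [Shrub.toZinb_apply, hedge, hne.symm]

/-! ### Hook products and linear extensions of forests -/

section Hook

variable {X Y M N : Type*} [Fintype X] [Fintype Y] [CommSemiring M] [CommSemiring N]

open Classical in
/-- The product, over the elements `x`, of the sums of the weights `u y` of the elements `y` that
are above `x` for the relation `R`. -/
noncomputable def hook (u : X → M) (R : X → X → Prop) : M :=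
  ∏ x, ∑ y with R x y, u y

open Classical in
theorem sum_filter_eq_add_sum_subtype_ne (x : X) (p : X → Prop) (u : X → M) :
    ∑ y with p y, u y = (if p x then u x else 0) + ∑ y : {y // y ≠ x} with p y.1, u y := by
  rw [Finset.sum_filter, Finset.sum_filter, Fintype.sum_eq_add_sum_subtype_ne _ x]

theorem map_hook {F : Type*} [FunLike F M N] [RingHomClass F M N] (φ : F) (u : X → M)
    (R : X → X → Prop) : φ (hook u R) = hook (fun x => φ (u x)) R := by
  simp [hook, map_prod, map_sum]

theorem hook_comp_equiv (e : X ≃ Y) (u : Y → M) (R : Y → Y → Prop) :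
    hook (fun x => u (e x)) (fun a b => R (e a) (e b)) = hook u R := by
  classical
  unfold hook
  rw [← e.prod_comp]
  refine Finset.prod_congr rfl fun x _ => ?_
  rw [Finset.sum_filter, Finset.sum_filter, ← e.sum_comp]

open Classical in
theorem hook_of_minimal (u : X → M) {R : X → X → Prop} {x : X} (hx : ∀ a, R a x → a = x) :
    hook u R = (∑ y with R x y, u y) *
      hook (fun a : {a // a ≠ x} => u a) (fun a b : {a // a ≠ x} => R a b) := by
  unfold hook
  rw [Fintype.prod_eq_mul_prod_subtype_ne _ x]
  congr 1
  refine Finset.prod_congr rfl fun a _ => ?_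
  rw [sum_filter_eq_add_sum_subtype_ne x, if_neg (fun h => a.2 (hx _ h)), zero_add]

open Classical in
theorem hook_of_maximal (u : X → M) {R : X → X → Prop} {x : X} (hx : ∀ a, R x a ↔ a = x) :
    hook u R = u x * ∏ a : {a // a ≠ x}, ∑ y with R a y, u y := by
  unfold hook
  rw [Fintype.prod_eq_mul_prod_subtype_ne _ x]
  congr 1
  rw [Finset.sum_filter]
  simp [hx]

end Hook

/-- Partial orders in which the elements below any given one form a chain: forests whose roots
are the minimal elements. -/
structure IsForestOrder {X : Type*} (R : X → X → Prop) : Prop where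
  refl : ∀ a, R a a
  trans : ∀ a b c, R a b → R b c → R a c
  antisymm : ∀ a b, R a b → R b a → a = b
  chain : ∀ a b c, R a c → R b c → R a b ∨ R b a

theorem IsForestOrder.comap {X Y : Type*} {R : X → X → Prop} (hR : IsForestOrder R) (f : Y → X)
    (hf : Function.Injective f) : IsForestOrder fun a b => R (f a) (f b) :=
  ⟨fun _ => hR.refl _, fun _ _ _ => hR.trans _ _ _, fun _ _ h h' => hf (hR.antisymm _ _ h h'),
    fun _ _ _ => hR.chain _ _ _⟩

theorem IsForestOrder.exists_minimal_le {X : Type*} [Finite X] {R : X → X → Prop}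
    (hR : IsForestOrder R) (y : X) : ∃ x, (∀ a, R a x → a = x) ∧ R x y := by
  let _ : PartialOrder X :=
    { le := R
      le_refl := hR.refl
      le_trans := hR.trans
      le_antisymm := hR.antisymm }
  obtain ⟨x, hxy, hx⟩ := (Set.toFinite {x : X | x ≤ y}).exists_le_minimal (a := y) (hR.refl y)
  exact ⟨x, fun a ha => hR.antisymm _ _ ha (hx.2 (hR.trans _ _ _ ha hx.1) ha), hx.1⟩

namespace TotalOrder

variable {X : Type}

/-- The total order that places a new first element `x` before a total order. -/
def extendBot (x : X) (τ : TotalOrder {a // a ≠ x}) : TotalOrder X where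
  le := fun a b => a = x ∨ ∃ (ha : a ≠ x) (hb : b ≠ x), τ.le ⟨a, ha⟩ ⟨b, hb⟩
  refl := fun a => or_iff_not_imp_left.2 fun ha => ⟨ha, ha, τ.refl _⟩
  trans := by
    rintro a b c (rfl | ⟨ha, hb, hab⟩) hbc
    · exact Or.inl rfl
    · obtain ⟨_, hc, hbc'⟩ := hbc.resolve_left hb
      exact Or.inr ⟨ha, hc, τ.trans _ _ _ hab hbc'⟩
  antisymm := by
    rintro a b (rfl | ⟨ha, hb, hab⟩) hba
    · by_contra h
      obtain ⟨-, ha, -⟩ := hba.resolve_left fun h' => h h'.symm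
      exact ha rfl
    · obtain ⟨_, _, hba'⟩ := hba.resolve_left hb
      exact congrArg Subtype.val (τ.antisymm _ _ hab hba')
  total := by
    intro a b
    by_cases ha : a = x
    · exact Or.inl (Or.inl ha)
    by_cases hb : b = x
    · exact Or.inr (Or.inl hb)
    exact (τ.total ⟨a, ha⟩ ⟨b, hb⟩).imp (fun h => Or.inr ⟨ha, hb, h⟩) fun h => Or.inr ⟨hb, ha, h⟩

theorem comap_extendBot (x : X) (τ : TotalOrder {a // a ≠ x}) :
    (extendBot x τ).comap Subtype.val Subtype.val_injective = τ := by
  refine (eq_of_le fun a b h => ?_).symm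
  exact Or.inr ⟨a.2, b.2, h⟩

theorem extendBot_comap {x : X} {τ : TotalOrder X} (hx : ∀ a, τ.le x a) :
    extendBot x (τ.comap Subtype.val Subtype.val_injective) = τ := by
  refine eq_of_le ?_
  rintro a b (rfl | ⟨_, _, h⟩)
  · exact hx b
  · exact h

/-- The total order that places a new last element `x` after a total order. -/
def extendTop (x : X) (τ : TotalOrder {a // a ≠ x}) : TotalOrder X :=
  (extendBot x τ.opposite).opposite

theorem le_extendTop (x : X) (τ : TotalOrder {a // a ≠ x}) (a : X) : (extendTop x τ).le a x :=
  Or.inl rfl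

theorem comap_extendTop (x : X) (τ : TotalOrder {a // a ≠ x}) :
    (extendTop x τ).comap Subtype.val Subtype.val_injective = τ :=
  congrArg opposite (comap_extendBot x τ.opposite)

theorem extendTop_comap {x : X} {τ : TotalOrder X} (hx : ∀ a, τ.le a x) :
    extendTop x (τ.comap Subtype.val Subtype.val_injective) = τ :=
  congrArg opposite (extendBot_comap (τ := τ.opposite) hx)

noncomputable instance [Finite X] : Fintype (TotalOrder X) :=
  Fintype.ofFinite _

open Classical in
/-- The linear extensions of `R` with first element `x` correspond to the linear extensions of the
restriction of `R` to the other elements. -/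
theorem sum_extensions_bot_eq [Fintype X] [Nonempty X] {K : Type*} [Field K] (u : X → K)
    {R : X → X → Prop} {x : X} (hx : ∀ a, R a x → a = x) :
    ∑ τ : TotalOrder X with (∀ a b, R a b → τ.le a b) ∧ τ.bot = x, (hook u τ.le)⁻¹ =
      (∑ y, u y)⁻¹ * ∑ τ : TotalOrder {a // a ≠ x} with (∀ a b, R a.1 b.1 → τ.le a b),
        (hook (fun a : {a // a ≠ x} => u a) τ.le)⁻¹ := by
  rw [Finset.mul_sum]
  refine Finset.sum_bij' (fun τ _ => τ.comap Subtype.val Subtype.val_injective)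
    (fun τ _ => extendBot x τ) ?_ ?_ ?_ ?_ ?_
  · intro τ hτ
    simp only [Finset.mem_filter, Finset.mem_univ, true_and] at hτ ⊢
    exact fun a b => hτ.1 a b
  · intro τ hτ
    simp only [Finset.mem_filter, Finset.mem_univ, true_and] at hτ ⊢
    refine ⟨fun a b hab => ?_, (eq_bot fun c => Or.inl rfl).symm⟩
    by_cases ha : a = x
    · exact Or.inl ha
    · have hb : b ≠ x := fun hb => ha (hx a (hb ▸ hab))
      exact Or.inr ⟨ha, hb, hτ ⟨a, ha⟩ ⟨b, hb⟩ hab⟩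
  · intro τ hτ
    simp only [Finset.mem_filter, Finset.mem_univ, true_and] at hτ
    exact extendBot_comap fun a => hτ.2 ▸ τ.bot_le a
  · intro τ _
    exact comap_extendBot x τ
  · intro τ hτ
    simp only [Finset.mem_filter, Finset.mem_univ, true_and] at hτ
    have hbot : ∀ a, τ.le x a := fun a => hτ.2 ▸ τ.bot_le a
    rw [hook_of_minimal u (x := x) fun a ha => τ.antisymm _ _ ha (hbot a), mul_inv]
    simp only [hbot, Finset.filter_true]
    rfl

open Classical in
/-- Hook formula: the sum over the linear extensions of a forest of their inverse hook products is
the inverse hook product of the forest. Sorting the linear extensions by their first element `x`,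
a root of the forest, reduces this to the fact that every element is above exactly one root. -/
theorem sum_inv_hook_extensions {K : Type*} [Field K] [Fintype X] (u : X → K)
    (hu : ∀ S : Finset X, S.Nonempty → ∑ x ∈ S, u x ≠ 0) {R : X → X → Prop}
    (hR : IsForestOrder R) :
    ∑ τ : TotalOrder X with (∀ a b, R a b → τ.le a b), (hook u τ.le)⁻¹ = (hook u R)⁻¹ := by
  induction hn : Fintype.card X generalizing X with
  | zero =>
    have := Fintype.card_eq_zero_iff.1 hn
    let τ₀ : TotalOrder X := ⟨fun _ _ => True, isEmptyElim, isEmptyElim, isEmptyElim, isEmptyElim⟩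
    have huniv : (Finset.univ.filter fun τ : TotalOrder X => ∀ a b, R a b → τ.le a b) = {τ₀} := by
      ext τ
      simp only [Finset.mem_filter, Finset.mem_univ, true_and, Finset.mem_singleton]
      exact ⟨fun _ => eq_of_le fun a => isEmptyElim a, fun _ a => isEmptyElim a⟩
    rw [huniv, Finset.sum_singleton]
    simp [hook]
  | succ n ih =>
    have : Nonempty X := Fintype.card_pos_iff.1 (by omega)
    have hsum : ∑ y, u y ≠ 0 := hu _ Finset.univ_nonempty
    -- the contribution of the linear extensions with first element `x`
    have key : ∀ x : X,
        ∑ τ : TotalOrder X with (∀ a b, R a b → τ.le a b) ∧ τ.bot = x, (hook u τ.le)⁻¹ =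
          (∑ y, u y)⁻¹ * (hook u R)⁻¹ *
            ∑ y, if (∀ a, R a x → a = x) ∧ R x y then u y else 0 := by
      intro x
      by_cases hx : ∀ a, R a x → a = x
      · rw [sum_extensions_bot_eq u hx,
          ih (fun a : {a // a ≠ x} => u a) ?_ (hR.comap Subtype.val Subtype.val_injective) ?_,
          hook_of_minimal u hx, ← Finset.sum_filter]
        · have hne : ∑ y with R x y, u y ≠ 0 := hu _ ⟨x, by simp [hR.refl]⟩
          have hx' : ∀ y, ((∀ a, R a x → a = x) ∧ R x y) ↔ R x y := fun y =>
            and_iff_right hx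
          simp only [hx']
          field_simp
        · intro S hS
          have := hu (S.map (Function.Embedding.subtype _)) (by simpa using hS)
          simpa using this
        · rw [Fintype.card_subtype_compl, Fintype.card_subtype_eq, hn]
          rfl
      · rw [Finset.filter_false_of_mem, Finset.sum_empty]
        · simp [hx]
        · rintro τ - ⟨hτ, rfl⟩
          exact hx fun a ha => τ.antisymm _ _ (hτ _ _ ha) (τ.bot_le a)
    have hroots : ∑ x, ∑ y, (if (∀ a, R a x → a = x) ∧ R x y then u y else 0) = ∑ y, u y := by
      rw [Finset.sum_comm]
      refine Finset.sum_congr rfl fun y _ => ?_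
      obtain ⟨x, hx, hxy⟩ := hR.exists_minimal_le y
      rw [Finset.sum_eq_single x]
      · exact if_pos ⟨hx, hxy⟩
      · rintro x' - hne
        refine if_neg ?_
        rintro ⟨hx', hxy'⟩
        rcases hR.chain _ _ _ hxy hxy' with h | h
        · exact hne (hx' _ h).symm
        · exact hne (hx _ h)
      · simp
    rw [← Finset.sum_fiberwise (Finset.univ.filter _) (fun τ : TotalOrder X => τ.bot)]
    simp only [Finset.filter_filter, key]
    rw [← Finset.mul_sum, hroots]
    field_simp

/-! ### The inclusion of the Zinbiel operad into moulds is a morphism -/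

variable {I J : Type}

/-- The partial order on `I \ {i} ⊔ J` whose linear extensions are the total orders occurring in
`π ∘_i σ`. Its Hasse diagram is a forest: a chain that branches at most once, at the minimum
of `σ`, into the rest of `σ` and the part of `π` above `i`. -/
def compositeRel (i : I) (π : TotalOrder I) (σ : TotalOrder J) :
    {a : I // a ≠ i} ⊕ J → {a : I // a ≠ i} ⊕ J → Prop
  | .inl a, .inl b => π.le a b
  | .inr a, .inr b => σ.le a b
  | .inl a, .inr _ => π.le a i
  | .inr b, .inl a => (∀ c, σ.le b c) ∧ π.le i a

theorem isComposite_iff_compositeRel (i : I) (π : TotalOrder I) (σ : TotalOrder J)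
    (τ : TotalOrder ({a : I // a ≠ i} ⊕ J)) :
    IsComposite i π σ τ ↔ ∀ a b, compositeRel i π σ a b → τ.le a b := by
  simp only [IsComposite, Sum.forall, compositeRel]
  grind

theorem isForestOrder_compositeRel (i : I) (π : TotalOrder I) (σ : TotalOrder J) :
    IsForestOrder (compositeRel i π σ) := by
  have p1 := π.refl
  have p2 := π.trans
  have p3 := π.antisymm
  have p4 := π.total
  have s1 := σ.refl
  have s2 := σ.trans
  have s3 := σ.antisymm
  have s4 := σ.total
  constructor
  · rintro (a | a)
    exacts [π.refl _, σ.refl _]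
  · rintro (⟨a, ha⟩ | a) (⟨b, hb⟩ | b) (⟨c, hc⟩ | c) <;> simp only [compositeRel] <;> grind
  · rintro (⟨a, ha⟩ | a) (⟨b, hb⟩ | b) <;> simp only [compositeRel] <;> grind
  · rintro (⟨a, ha⟩ | a) (⟨b, hb⟩ | b) (⟨c, hc⟩ | c) <;> simp only [compositeRel] <;> grind

open Classical in
/-- The hook product of the forest of a composition. Its factor at the minimum of `σ` is the factor
at `i` of `π`, which replaces the total weight of `σ`. -/
theorem hook_compositeRel_mul [Fintype I] [Fintype J] [Nonempty J] {M : Type*} [CommSemiring M]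
    (i : I) (u : {a : I // a ≠ i} ⊕ J → M) (π : TotalOrder I) (σ : TotalOrder J) :
    hook u (compositeRel i π σ) * ∑ j, u (.inr j) =
      hook (fun j => u (.inr j)) σ.le *
        hook (fun a => if h : a = i then ∑ j, u (.inr j) else u (.inl ⟨a, h⟩)) π.le := by
  have hl : ∀ a : I, ∑ y with π.le a y, (if h : y = i then ∑ j, u (.inr j) else u (.inl ⟨y, h⟩)) =
      (if π.le a i then ∑ j, u (.inr j) else 0) +
        ∑ y : {a : I // a ≠ i} with π.le a y.1, u (.inl y) := by
    intro a
    rw [sum_filter_eq_add_sum_subtype_ne i, dif_pos rfl]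
    congr 1
    exact Finset.sum_congr rfl fun y _ => dif_neg y.2
  have hbot : ∑ j with σ.le σ.bot j, u (.inr j) = ∑ j, u (.inr j) := by
    simp [σ.bot_le]
  have hsplit : ∀ x, ∑ y with compositeRel i π σ x y, u y =
      (∑ y with compositeRel i π σ x (.inl y), u (.inl y)) +
        ∑ y with compositeRel i π σ x (.inr y), u (.inr y) := by
    intro x
    simp only [Finset.sum_filter, Fintype.sum_sum_type]
  unfold hook
  rw [Fintype.prod_sum_type, Fintype.prod_eq_mul_prod_subtype_ne _ i,
    Fintype.prod_eq_mul_prod_subtype_ne _ σ.bot, Fintype.prod_eq_mul_prod_subtype_ne _ σ.bot]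
  have h1 : ∀ a : {a : I // a ≠ i}, ∑ y with compositeRel i π σ (.inl a) y, u y =
      ∑ y with π.le a y, (if h : y = i then ∑ j, u (.inr j) else u (.inl ⟨y, h⟩)) := by
    intro a
    rw [hl, hsplit, add_comm]
    congr 1
    by_cases h : π.le a i <;> simp [compositeRel, h]
  have h2 : ∑ y with compositeRel i π σ (.inr σ.bot) y, u y =
      ∑ y with π.le i y, (if h : y = i then ∑ j, u (.inr j) else u (.inl ⟨y, h⟩)) := by
    rw [hl, hsplit, add_comm, if_pos (π.refl i)]
    simp [compositeRel, σ.bot_le]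
  have h3 : ∀ b : {b : J // b ≠ σ.bot}, ∑ y with compositeRel i π σ (.inr b) y, u y =
      ∑ j with σ.le b j, u (.inr j) := by
    intro b
    have hb : ¬ ∀ c, σ.le b c := fun h => b.2 (eq_bot h)
    rw [hsplit]
    simp only [compositeRel, hb, false_and, Finset.filter_false, Finset.sum_empty, zero_add]
    congr!
  simp only [h1, h2, h3, hbot]
  ring

end TotalOrder

namespace Fractions

variable {k : Type*} [Field k] {I J : Type}

theorem sum_X_ne_zero {S : Finset I} (hS : S.Nonempty) :
    (∑ i ∈ S, MvPolynomial.X i : MvPolynomial I k) ≠ 0 := by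
  classical
  obtain ⟨j, hj⟩ := hS
  intro h
  have := congrArg (MvPolynomial.eval (Pi.single j (1 : k))) h
  simp [hj, Pi.single_apply] at this

theorem sum_u_ne_zero {S : Finset I} (hS : S.Nonempty) : ∑ i ∈ S, u k i ≠ 0 := by
  unfold u
  rw [← map_sum]
  exact fun h => sum_X_ne_zero hS ((IsFractionRing.injective (MvPolynomial I k) _).eq_iff.1
    (h.trans (map_zero _).symm))

theorem relabel_u (e : I ≃ J) (i : I) : relabel k e (u k i) = u k (e i) := by
  simp [relabel, u]

theorem relabel_smul (e : I ≃ J) (c : k) (z : Fractions k I) :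
    relabel k e (c • z) = c • relabel k e z := by
  rw [Algebra.smul_def, Algebra.smul_def, map_mul,
    IsScalarTower.algebraMap_apply k (MvPolynomial I k) (Fractions k I),
    IsScalarTower.algebraMap_apply k (MvPolynomial J k) (Fractions k J)]
  simp [relabel, MvPolynomial.algebraMap_eq]

theorem incl_u (i : I) (j : J) : incl k i (u k j) = u k (.inr j) := by
  simp [incl, u]

theorem incl_smul (i : I) (c : k) (z : Fractions k J) :
    incl k i (c • z) = c • incl k i z := by
  rw [Algebra.smul_def, Algebra.smul_def, map_mul,
    IsScalarTower.algebraMap_apply k (MvPolynomial J k) (Fractions k J),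
    IsScalarTower.algebraMap_apply k (MvPolynomial ({a : I // a ≠ i} ⊕ J) k)
      (Fractions k ({a : I // a ≠ i} ⊕ J))]
  simp [incl, MvPolynomial.algebraMap_eq]

open Classical in
theorem subst_u [Fintype J] [Nonempty J] (i : I) (a : I) :
    subst k (J := J) i (u k a) =
      if h : a = i then ∑ j, u k (.inr j) else u k (.inl ⟨a, h⟩) := by
  by_cases h : a = i <;> simp [subst, u, polySubst, h, finsum_eq_sum_of_fintype]

theorem subst_smul [Finite J] [Nonempty J] (i : I) (c : k) (z : Fractions k I) :
    subst k (J := J) i (c • z) = c • subst k (J := J) i z := by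
  rw [Algebra.smul_def, Algebra.smul_def, map_mul,
    IsScalarTower.algebraMap_apply k (MvPolynomial I k) (Fractions k I),
    IsScalarTower.algebraMap_apply k (MvPolynomial ({a : I // a ≠ i} ⊕ J) k)
      (Fractions k ({a : I // a ≠ i} ⊕ J))]
  simp [subst, MvPolynomial.algebraMap_eq]

end Fractions

section zinbToMould

variable {k : Type*} [Field k] {I J : Type}

theorem zinbToMould_eq_sum [Fintype I] (x : TotalOrder I →₀ k) :
    zinbToMould k I x = x.sum fun π a => a • (hook (Fractions.u k) π.le)⁻¹ := by
  classical
  unfold zinbToMould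
  rw [Finsupp.linearCombination_apply]
  refine Finsupp.sum_congr fun π _ => ?_
  rw [one_div, finprod_eq_prod_of_fintype]
  congr 2
  refine Finset.prod_congr rfl fun a _ => ?_
  exact finsum_cond_eq_sum_of_cond_iff _ (by simp)

theorem zinbToMould_single [Fintype I] (π : TotalOrder I) :
    zinbToMould k I (Finsupp.single π 1) = (hook (Fractions.u k) π.le)⁻¹ := by
  simp [zinbToMould_eq_sum]

theorem zinbToMould_map [Finite I] (e : I ≃ J) (x : TotalOrder I →₀ k) :
    zinbToMould k J (x.mapDomain (TotalOrder.relabel e)) =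
      Fractions.relabel k e (zinbToMould k I x) := by
  have := Fintype.ofFinite I
  have := Fintype.ofEquiv I e
  induction x using Finsupp.induction_linear with
  | zero => simp
  | add x y hx hy => rw [Finsupp.mapDomain_add, map_add, hx, hy, map_add, map_add]
  | single π a =>
    rw [Finsupp.mapDomain_single, zinbToMould_eq_sum, zinbToMould_eq_sum,
      Finsupp.sum_single_index (by simp), Finsupp.sum_single_index (by simp),
      Fractions.relabel_smul, map_inv₀, map_hook]
    simp only [Fractions.relabel_u]
    rw [← hook_comp_equiv e]
    simp [TotalOrder.relabel]

theorem zinbToMould_zinbBasisComp [Fintype I] [Fintype J] [Nonempty J] (i : I) (π : TotalOrder I)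
    (σ : TotalOrder J) :
    zinbToMould k _ (zinbBasisComp k i π σ) =
      (∑ j : J, Fractions.u k (.inr j)) * Fractions.incl k i (hook (Fractions.u k) σ.le)⁻¹ *
        Fractions.subst k i (hook (Fractions.u k) π.le)⁻¹ := by
  classical
  have hJ : ∑ j : J, Fractions.u k (Sum.inr j : {a : I // a ≠ i} ⊕ J) ≠ 0 := by
    have := Fractions.sum_u_ne_zero (k := k)
      (S := Finset.univ.map (Function.Embedding.inr : J ↪ {a : I // a ≠ i} ⊕ J)) (by simp)
    simpa using this
  have hsum : zinbToMould k _ (zinbBasisComp k i π σ) =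
      (hook (Fractions.u k) (TotalOrder.compositeRel i π σ))⁻¹ := by
    rw [← TotalOrder.sum_inv_hook_extensions _ (fun S => Fractions.sum_u_ne_zero)
      (TotalOrder.isForestOrder_compositeRel i π σ)]
    simp only [zinbBasisComp, map_sum, zinbToMould_single]
    refine Finset.sum_congr ?_ fun _ _ => rfl
    ext τ
    simp [TotalOrder.isComposite_iff_compositeRel]
  have hmul := TotalOrder.hook_compositeRel_mul i (Fractions.u k) π σ
  rw [hsum, map_inv₀, map_inv₀, map_hook, map_hook]
  simp only [Fractions.incl_u, Fractions.subst_u]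
  rw [mul_assoc, ← mul_inv, ← hmul, mul_inv, mul_left_comm, mul_inv_cancel₀ hJ, mul_one]

theorem zinbToMould_comp [Finite I] [Fintype J] [Nonempty J] (i : I) (x : TotalOrder I →₀ k)
    (y : TotalOrder J →₀ k) :
    zinbToMould k _ (x.sum fun π a => y.sum fun σ b => (a * b) • zinbBasisComp k i π σ) =
      (∑ j : J, Fractions.u k (.inr j)) * Fractions.incl k i (zinbToMould k J y) *
        Fractions.subst k i (zinbToMould k I x) := by
  have := Fintype.ofFinite I
  rw [zinbToMould_eq_sum x, zinbToMould_eq_sum y]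
  simp only [Finsupp.sum, map_sum, map_smul, zinbToMould_zinbBasisComp, Fractions.incl_smul,
    Fractions.subst_smul, Finset.mul_sum, Finset.sum_mul]
  refine Finset.sum_congr rfl fun π _ => Finset.sum_congr rfl fun σ _ => ?_
  simp only [mul_smul, smul_mul_assoc, mul_smul_comm, Finset.smul_sum]

variable (k) in
/-- The composite of the morphism from shrubs to the Zinbiel operad with the inclusion into
moulds. -/
noncomputable def arbToMould : OperadHom Arb (Mould k) where
  toFun := fun I _ _ P => zinbToMould k I (P.toZinb k)
  map_relabel := by
    intro I J _ _ _ _ e P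
    exact (congrArg (zinbToMould k J) ((arbToZinb k).map_relabel e P)).trans
      (zinbToMould_map e (P.toZinb k))
  map_unit := by
    refine (congrArg (zinbToMould k Unit) (arbToZinb k).map_unit).trans
      ((zinbToMould_single TotalOrder.point).trans ?_)
    simp [hook, TotalOrder.point, Mould]
  map_comp := by
    intro I J _ _ _ _ i P Q
    have := Fintype.ofFinite J
    refine (congrArg (zinbToMould k _) ((arbToZinb k).map_comp i P Q)).trans
      ((zinbToMould_comp i (P.toZinb k) (Q.toZinb k)).trans ?_)
    rw [← finsum_eq_sum_of_fintype]
    rfl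

theorem hasMouldValues_arbToMould : HasMouldValues k (arbToMould k) := by
  obtain ⟨h1, h2⟩ := hasZinbValues_arbToZinb k
  have hu : ∀ i : Fin 2, Fractions.u k i ≠ 0 := fun i => by
    simpa using Fractions.sum_u_ne_zero (k := k) (Finset.singleton_nonempty i)
  have hsum : Fractions.u k (0 : Fin 2) + Fractions.u k 1 ≠ 0 := by
    simpa using Fractions.sum_u_ne_zero (k := k) (Finset.univ_nonempty (α := Fin 2))
  have hinc : hook (Fractions.u k) (TotalOrder.increasing 2).le =
      (Fractions.u k 0 + Fractions.u k 1) * Fractions.u k 1 := by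
    simp only [hook, Fin.prod_univ_two, Finset.sum_filter, Fin.sum_univ_two]
    simp [TotalOrder.increasing]
  have hdec : hook (Fractions.u k) (TotalOrder.decreasing 2).le =
      Fractions.u k 0 * (Fractions.u k 0 + Fractions.u k 1) := by
    simp only [hook, Fin.prod_univ_two, Finset.sum_filter, Fin.sum_univ_two]
    simp [TotalOrder.decreasing]
  constructor
  · refine (congrArg (zinbToMould k (Fin 2)) h1).trans ((zinbToMould_single _).trans ?_)
    rw [hdec, one_div]
  · refine (congrArg (zinbToMould k (Fin 2)) h2).trans ((map_add _ _ _).trans ?_)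
    rw [zinbToMould_single, zinbToMould_single, hinc, hdec]
    have := hu 0
    have := hu 1
    field_simp

/-! ### Linear independence of the inverse hook products -/

/-- The fraction `y` over `S` is obtained from the fraction `x` over `R` by applying the morphism
`φ : R → S` to the numerator and the denominator of a suitable expression of `x`. -/
def IsSpecialization {R S K L : Type*} [CommRing R] [CommRing S] [Field K] [Field L] [Algebra R K]
    [Algebra S L] (φ : R →+* S) (x : K) (y : L) : Prop :=
  ∃ a b, φ b ≠ 0 ∧ x * algebraMap R K b = algebraMap R K a ∧
    y * algebraMap S L (φ b) = algebraMap S L (φ a)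

namespace IsSpecialization

variable {R S K L : Type*} [CommRing R] [CommRing S] [Field K] [Field L] [Algebra R K]
  [Algebra S L] {φ : R →+* S}

theorem add [IsDomain S] {x x' : K} {y y' : L} (h : IsSpecialization φ x y)
    (h' : IsSpecialization φ x' y') : IsSpecialization φ (x + x') (y + y') := by
  obtain ⟨a, b, hb, h1, h2⟩ := h
  obtain ⟨a', b', hb', h1', h2'⟩ := h'
  refine ⟨a * b' + a' * b, b * b', by rw [map_mul]; exact mul_ne_zero hb hb', ?_, ?_⟩
  · simp only [map_mul, map_add, ← h1, ← h1']
    ring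
  · simp only [map_mul, map_add, ← h2, ← h2']
    ring

theorem sum [IsDomain S] {ι : Type*} (s : Finset ι) {x : ι → K} {y : ι → L}
    (h : ∀ i ∈ s, IsSpecialization φ (x i) (y i)) :
    IsSpecialization φ (∑ i ∈ s, x i) (∑ i ∈ s, y i) := by
  classical
  induction s using Finset.induction_on with
  | empty => exact ⟨0, 1, by simp, by simp, by simp⟩
  | insert i s hi ih =>
    rw [Finset.sum_insert hi, Finset.sum_insert hi]
    exact (h i (Finset.mem_insert_self i s)).add
      (ih fun j hj => h j (Finset.mem_insert_of_mem hj))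

theorem eq_zero [IsFractionRing R K] [IsFractionRing S L] {y : L}
    (h : IsSpecialization φ (0 : K) y) : y = 0 := by
  obtain ⟨a, b, hb, h1, h2⟩ := h
  have ha : a = 0 := IsFractionRing.injective R K (by rw [← h1, zero_mul, map_zero])
  rw [ha, map_zero, map_zero] at h2
  refine (mul_eq_zero.1 h2).resolve_right fun h => hb ?_
  exact IsFractionRing.injective S L (h.trans (map_zero _).symm)

end IsSpecialization

open Classical in
/-- The morphism of polynomial rings that kills the variable `m`. -/
noncomputable def killVariable (k : Type*) [Field k] (m : I) :
    MvPolynomial I k →ₐ[k] MvPolynomial {a : I // a ≠ m} k :=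
  MvPolynomial.aeval fun a => if h : a = m then 0 else MvPolynomial.X ⟨a, h⟩

open Classical in
theorem killVariable_sum [Fintype I] (m : I) (p : I → Prop) :
    killVariable k m (∑ y with p y, MvPolynomial.X y) =
      ∑ y : {a : I // a ≠ m} with p y.1, MvPolynomial.X y := by
  rw [sum_filter_eq_add_sum_subtype_ne m, map_add, map_sum]
  have h0 : killVariable k m (if p m then MvPolynomial.X m else 0) = 0 := by
    split_ifs <;> simp [killVariable]
  rw [h0, zero_add]
  refine Finset.sum_congr rfl fun y _ => ?_
  simp [killVariable, y.2]

open Classical in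
/-- The residue at `u_m = 0` of an inverse hook product: it vanishes unless `m` comes last,
in which case `m` is removed from the total order. -/
theorem isSpecialization_hook [Fintype I] (m : I) (π : TotalOrder I) (c : k) :
    IsSpecialization (killVariable k m : MvPolynomial I k →+* MvPolynomial {a : I // a ≠ m} k)
      (Fractions.u k m * c • (hook (Fractions.u k) π.le)⁻¹)
      (if ∀ a, π.le a m then c • (hook (Fractions.u k)
        (π.comap (Subtype.val : {a : I // a ≠ m} → I) Subtype.val_injective).le)⁻¹ else 0) := by
  have hX : ∀ {X : Type} [Fintype X] (R : X → X → Prop), hook (Fractions.u k) R =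
      algebraMap (MvPolynomial X k) (Fractions k X) (hook MvPolynomial.X R) := fun R =>
    (map_hook (algebraMap _ _) _ R).symm
  have hne : ∀ {X : Type} [Fintype X] (τ : TotalOrder X), hook (Fractions.u k) τ.le ≠ 0 := by
    intro X _ τ
    exact Finset.prod_ne_zero_iff.2 fun a _ =>
      Fractions.sum_u_ne_zero ⟨a, by simp [τ.refl]⟩
  have hum : Fractions.u k m ≠ 0 := by
    simpa using Fractions.sum_u_ne_zero (k := k) (Finset.singleton_nonempty m)
  have hc : ∀ {X : Type} (c : k) (z : Fractions k X), c • z =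
      algebraMap (MvPolynomial X k) (Fractions k X) (MvPolynomial.C c) * z := by
    intro X c z
    rw [Algebra.smul_def, IsScalarTower.algebraMap_apply k (MvPolynomial X k) (Fractions k X),
      MvPolynomial.algebraMap_eq]
  split_ifs with hm
  · let e : MvPolynomial I k := ∏ a : {a : I // a ≠ m}, ∑ y with π.le a y, MvPolynomial.X y
    have he : hook MvPolynomial.X π.le = MvPolynomial.X m * e :=
      hook_of_maximal _ fun a => ⟨fun h => π.antisymm _ _ (hm a) h, fun h => h ▸ π.refl _⟩
    have hφe : killVariable k m e = hook MvPolynomial.X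
        (π.comap (Subtype.val : {a : I // a ≠ m} → I) Subtype.val_injective).le := by
      rw [map_prod]
      exact Finset.prod_congr rfl fun a _ => killVariable_sum m _
    have hne' := hne (π.comap (Subtype.val : {a : I // a ≠ m} → I) Subtype.val_injective)
    have hne'' := hne π
    rw [hX, he, map_mul] at hne''
    have he0 := right_ne_zero_of_mul hne''
    -- the fraction is `c / e`: the factor `u_m` of the hook product cancels
    refine ⟨MvPolynomial.C c, e, fun h => hne' ?_, ?_, ?_⟩
    · rw [hX, ← hφe]
      exact (congrArg _ h).trans (map_zero _)
    · rw [hc, hX, he, map_mul]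
      change Fractions.u k m * (_ * (Fractions.u k m * _)⁻¹) * _ = _
      field_simp
    · rw [hc, AlgHom.coe_toRingHom, hφe, ← hX, mul_assoc, inv_mul_cancel₀ hne', mul_one]
      simp [killVariable, MvPolynomial.algebraMap_eq]
  · push Not at hm
    obtain ⟨b, hb⟩ := hm
    -- no factor of the hook product vanishes at `u_m = 0`, since `m` is not last
    have hmb : π.le m b := (π.total m b).resolve_right hb
    refine ⟨MvPolynomial.X m * MvPolynomial.C c, hook MvPolynomial.X π.le, ?_, ?_, ?_⟩
    · rw [AlgHom.coe_toRingHom]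
      unfold hook
      rw [map_prod]
      refine Finset.prod_ne_zero_iff.2 fun a _ => ?_
      rw [killVariable_sum]
      apply Fractions.sum_X_ne_zero
      by_cases ha : a = m
      · exact ⟨⟨b, fun h => hb (h ▸ π.refl _)⟩, by simp [ha, hmb]⟩
      · exact ⟨⟨a, ha⟩, by simp [π.refl]⟩
    · rw [hc, ← hX, map_mul, mul_assoc, mul_assoc, inv_mul_cancel₀ (hne π), mul_one]
      rfl
    · have h0 : killVariable k m (MvPolynomial.X m) = 0 := by simp [killVariable]
      rw [AlgHom.coe_toRingHom, map_mul, h0, zero_mul, zero_mul, map_zero]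

/-- The inclusion of the Zinbiel operad into moulds is injective: the coefficients of the total
orders ending with `m` are recovered, by induction on the number of labels, from the residue
at `u_m = 0`. -/
theorem zinbToMould_injective (k : Type*) [Field k] (I : Type) [Finite I] :
    Function.Injective (zinbToMould k I) := by
  classical
  suffices h : ∀ (n : ℕ) (I : Type) [Fintype I], Fintype.card I = n →
      ∀ x : TotalOrder I →₀ k, zinbToMould k I x = 0 → x = 0 by
    have := Fintype.ofFinite I
    rw [injective_iff_map_eq_zero]
    exact h _ I rfl
  intro n
  induction n with
  | zero =>
    intro I _ hI x hx
    have := Fintype.card_eq_zero_iff.1 hI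
    ext τ
    have hτ : ∀ π : TotalOrder I, π = τ := fun π => TotalOrder.eq_of_le fun a => isEmptyElim a
    rw [zinbToMould_eq_sum, Finsupp.sum_fintype _ _ (by simp),
      Fintype.sum_eq_single τ fun π h => absurd (hτ π) h] at hx
    simpa [hook] using hx
  | succ n ih =>
    intro I _ hI x hx
    have : Nonempty I := Fintype.card_pos_iff.1 (by omega)
    ext τ
    obtain ⟨m, hm⟩ := τ.exists_top
    let x' : TotalOrder {a : I // a ≠ m} →₀ k :=
      Finsupp.equivFunOnFinite.symm fun σ => x (σ.extendTop m)
    have hspec := IsSpecialization.sum Finset.univ fun π _ => isSpecialization_hook m π (x π)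
    have hx' : zinbToMould k _ x' = 0 := by
      rw [← Finset.mul_sum] at hspec
      rw [zinbToMould_eq_sum, Finsupp.sum_fintype _ _ (by simp)] at hx
      rw [hx, mul_zero, ← Finset.sum_filter] at hspec
      rw [zinbToMould_eq_sum, Finsupp.sum_fintype _ _ (by simp), ← hspec.eq_zero]
      refine Finset.sum_bij' (fun σ _ => σ.extendTop m)
        (fun π _ => π.comap Subtype.val Subtype.val_injective) ?_ ?_ ?_ ?_ ?_
      · intro σ _
        simpa using TotalOrder.le_extendTop m σ
      · simp
      · intro σ _
        exact TotalOrder.comap_extendTop m σ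
      · intro π hπ
        exact TotalOrder.extendTop_comap (by simpa using hπ)
      · intro σ _
        rw [TotalOrder.comap_extendTop]
        rfl
    have hzero := ih {a : I // a ≠ m}
      (by rw [Fintype.card_subtype_compl, Fintype.card_subtype_eq, hI]; rfl) x' hx'
    have := DFunLike.congr_fun hzero (τ.comap Subtype.val Subtype.val_injective)
    rw [← TotalOrder.extendTop_comap hm]
    exact this

end zinbToMould

/-! ### Existence, uniqueness and injectivity of the two morphisms -/

theorem mainTheorem3 (k : Type*) [Field k] :
    -- the morphisms of operads `γ` and `κ` exist and are unique
    (∃! γ : OperadHom Arb (Zinb k), HasZinbValues k γ) ∧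
    (∃! κ : OperadHom Arb (Mould k), HasMouldValues k κ) ∧
    ∀ (γ : OperadHom Arb (Zinb k)) (κ : OperadHom Arb (Mould k)),
      HasZinbValues k γ → HasMouldValues k κ →
      -- `κ` is the composite of `γ` with the inclusion of `Zinb` into `Mould`
      (∀ (I : Type) [Finite I] [Nonempty I] (P : Shrub I),
        κ.toFun I P = zinbToMould k I (γ.toFun I P)) ∧
      -- both are injective
      (∀ (I : Type) [Finite I] [Nonempty I], Function.Injective (γ.toFun I)) ∧
      (∀ (I : Type) [Finite I] [Nonempty I], Function.Injective (κ.toFun I)) := by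
  have hγ : ∀ γ : OperadHom Arb (Zinb k), HasZinbValues k γ → γ = arbToZinb k := fun γ h =>
    OperadHom.arb_ext (h.1.trans (hasZinbValues_arbToZinb k).1.symm)
      (h.2.trans (hasZinbValues_arbToZinb k).2.symm)
  have hκ : ∀ κ : OperadHom Arb (Mould k), HasMouldValues k κ → κ = arbToMould k := fun κ h =>
    OperadHom.arb_ext (h.1.trans hasMouldValues_arbToMould.1.symm)
      (h.2.trans hasMouldValues_arbToMould.2.symm)
  refine ⟨⟨arbToZinb k, hasZinbValues_arbToZinb k, hγ⟩,
    ⟨arbToMould k, hasMouldValues_arbToMould, hκ⟩, ?_⟩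
  intro γ κ h h'
  obtain rfl := hγ γ h
  obtain rfl := hκ κ h'
  exact ⟨fun I _ _ P => rfl, fun I _ _ => Shrub.toZinb_injective k,
    fun I _ _ => (zinbToMould_injective k I).comp (Shrub.toZinb_injective k)⟩
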